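/- Notation. Let $B_{c_0}$ be the open unit ball of the complex Banach space $c_0$ and $\mathbb D$ the open unit disk of $\mathbb C$. $\mathcal H^\infty(B_{c_0})$ and $\mathcal H^\infty(B_{c_0},\ell_\infty)$ are the spaces of bounded holomorphic functions on $B_{c_0}$ with values in $\mathbb C$ and in $\ell_\infty$ respectively, $\mathcal A_u(B_{c_0})$ is the algebra of uniformly continuous holomorphic functions $B_{c_0}\to\mathbb C$, and $\mathcal A(\mathbb D)$ is the algebra of continuous functions on $\overline{\mathbb D}$ that are holomorphic in $\mathbb D$; all carry the supremum norm. For Banach algebras $\mathcal A,\mathcal B$, let $\mathcal M(\mathcal A,\mathcal B)$ be the set of nonzero algebra homomorphisms $\mathcal A\to\mathcal B$, and write $\mathcal M_{u,\infty}(B_{c_0},B_{c_0})=\mathcal M(\mathcal A_u(B_{c_0}),\mathcal H^\infty(B_{c_0}))$. The Gleason part of $\Phi\in\mathcal M(\mathcal A,\mathcal B)$ is $\mathcal{GP}(\Phi)=\{\Psi\in\mathcal M(\mathcal A,\mathcal B):\ \sup_{\|f\|\le 1}\|\Phi(f)-\Psi(f)\|<2\}$, and $\Phi$ is called isolated in $\mathcal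 M(\mathcal A,\mathcal B)$ if $\mathcal{GP}(\Phi)=\{\Phi\}$. For $f\in\mathcal A_u(B_{c_0})$ let $\widetilde f$ be its canonical (Aron--Berner) extension to the open unit ball of $c_0^{**}=\ell_\infty$, extended by continuity to the closed ball $\overline B_{\ell_\infty}$. Lemma. Let $g=(g_n)_n$ belong to the closed unit ball of $\mathcal H^\infty(B_{c_0},\ell_\infty)$. Then $C_g(f)=\widetilde f\circ g$ defines an element $C_g$ of $\mathcal M_{u,\infty}(B_{c_0},B_{c_0})$, for every $n\in\mathbb N$ the formula $C_{g_n}(f)=f\circ g_n$ defines an element $C_{g_n}$ of $\mathcal M(\mathcal A(\mathbb D),\mathcal H^\infty(B_{c_0}))$, and $C_g$ is isolated in $\mathcal M_{u,\infty}(B_{c_0},B_{c_0})$ if and only if $C_{g_n}$ is isolated in $\mathcal M(\mathcal A(\mathbb D),\mathcal H^\infty(B_{c_0}))$ for all $n\in\mathbb N$. -/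

import Mathlib

open Metric
open scoped BoundedContinuousFunction ZeroAtInfty ENNReal ComplexConjugate

noncomputable section

namespace PolydiskHom

section Algebras

variable (E : Type*) [NormedAddCommGroup E] [NormedSpace ℂ E]

/-- A function defined on the open unit ball of `E` is holomorphic if it is complex
(Fréchet) differentiable at every point of the ball.  The values outside the ball used to write
this down play no role, since the ball is open. -/
def IsHolomorphic {E : Type*} [NormedAddCommGroup E] [NormedSpace ℂ E]
    {F : Type*} [NormedAddCommGroup F] [NormedSpace ℂ F] (f : ball (0 : E) 1 → F) : Prop :=
  DifferentiableOn ℂ (Function.extend Subtype.val f 0) (ball (0 : E) 1)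

theorem isHolomorphic_iff {E : Type*} [NormedAddCommGroup E] [NormedSpace ℂ E]
    {F : Type*} [NormedAddCommGroup F] [NormedSpace ℂ F] (f : ball (0 : E) 1 → F) :
    IsHolomorphic f ↔
      ∃ G : E → F, DifferentiableOn ℂ G (ball (0 : E) 1) ∧ ∀ x : ball (0 : E) 1, f x = G x := by
  constructor
  · intro h
    exact ⟨_, h, fun x => (Subtype.val_injective.extend_apply f 0 x).symm⟩
  · rintro ⟨G, hG, hf⟩
    refine hG.congr fun x hx => ?_
    exact (Subtype.val_injective.extend_apply f 0 ⟨x, hx⟩).trans (hf ⟨x, hx⟩)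

/-- The algebra of bounded holomorphic complex functions on the open unit ball of `E`, with
the supremum norm. -/
def HInfty : Subalgebra ℂ (ball (0 : E) 1 →ᵇ ℂ) where
  carrier := {f | IsHolomorphic f}
  add_mem' := by
    intro f g hf hg
    obtain ⟨G, hG, h⟩ := (isHolomorphic_iff _).1 hf
    obtain ⟨G', hG', h'⟩ := (isHolomorphic_iff _).1 hg
    exact (isHolomorphic_iff _).2 ⟨_, hG.add hG', fun x => by simp [h x, h' x]⟩
  mul_mem' := by
    intro f g hf hg
    obtain ⟨G, hG, h⟩ := (isHolomorphic_iff _).1 hf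
    obtain ⟨G', hG', h'⟩ := (isHolomorphic_iff _).1 hg
    exact (isHolomorphic_iff _).2 ⟨_, hG.mul hG', fun x => by simp [h x, h' x]⟩
  algebraMap_mem' := fun c =>
    (isHolomorphic_iff _).2 ⟨fun _ => c, differentiableOn_const _, fun _ => rfl⟩

/-- The algebra of uniformly continuous holomorphic functions on the open unit ball of `E`, with
the supremum norm (such functions are automatically bounded). -/
def AUnif : Subalgebra ℂ (ball (0 : E) 1 →ᵇ ℂ) where
  carrier := {f | IsHolomorphic f ∧ UniformContinuous f}
  add_mem' := fun hf hg => ⟨(HInfty E).add_mem' hf.1 hg.1, hf.2.add hg.2⟩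
  mul_mem' := by
    intro f g hf hg
    refine ⟨(HInfty E).mul_mem' hf.1 hg.1, ?_⟩
    have hmul : UniformContinuousOn (fun p : ℂ × ℂ => p.1 * p.2)
        (closedBall (0 : ℂ) ‖f‖ ×ˢ closedBall (0 : ℂ) ‖g‖) :=
      ((isCompact_closedBall _ _).prod (isCompact_closedBall _ _)).uniformContinuousOn_of_continuous
        continuous_mul.continuousOn
    have := hmul.comp (g := fun p : ℂ × ℂ => p.1 * p.2)
      (f := fun x => (f x, g x)) (s := Set.univ)
      (uniformContinuousOn_univ.2 (hf.2.prodMk hg.2))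
      (fun x _ => ⟨by simpa using f.norm_coe_le_norm x, by simpa using g.norm_coe_le_norm x⟩)
    exact uniformContinuousOn_univ.1 this
  algebraMap_mem' := fun c => ⟨(HInfty E).algebraMap_mem' c, uniformContinuous_const⟩

end Algebras

/-- The disk algebra: continuous functions on the closed unit disk that are holomorphic
in the open unit disk, with the supremum norm. -/
def DiskAlgebra : Subalgebra ℂ C(closedBall (0 : ℂ) 1, ℂ) where
  carrier := {f | IsHolomorphic fun z : ball (0 : ℂ) 1 => f ⟨z, ball_subset_closedBall z.2⟩}
  add_mem' := by
    intro f g hf hg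
    obtain ⟨G, hG, h⟩ := (isHolomorphic_iff _).1 hf
    obtain ⟨G', hG', h'⟩ := (isHolomorphic_iff _).1 hg
    exact (isHolomorphic_iff _).2 ⟨_, hG.add hG', fun x => by simp [h x, h' x]⟩
  mul_mem' := by
    intro f g hf hg
    obtain ⟨G, hG, h⟩ := (isHolomorphic_iff _).1 hf
    obtain ⟨G', hG', h'⟩ := (isHolomorphic_iff _).1 hg
    exact (isHolomorphic_iff _).2 ⟨_, hG.mul hG', fun x => by simp [h x, h' x]⟩
  algebraMap_mem' := fun c =>
    (isHolomorphic_iff _).2 ⟨fun _ => c, differentiableOn_const _, fun _ => rfl⟩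

section Spectrum

variable (A B : Type*) [NormedCommRing A] [NormedAlgebra ℂ A]
  [NormedCommRing B] [NormedAlgebra ℂ B]

/-- The vector-valued spectrum: all nonzero algebra homomorphisms from `A` to `B` (they are not
required to preserve the unit, nor to be continuous). -/
def VectorSpectrum : Type _ := {Φ : A →ₙₐ[ℂ] B // Φ ≠ 0}

variable {A B}

instance : CoeFun (VectorSpectrum A B) (fun _ => A → B) := ⟨fun Φ => Φ.1⟩

/-- The operator norm distance between two homomorphisms, the supremum being taken in
`[0, ∞]`. -/
def gleasonDist (Φ Ψ : VectorSpectrum A B) : ℝ≥0∞ :=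
  ⨆ (f : A) (_ : ‖f‖ ≤ 1), ‖Φ f - Ψ f‖ₑ

/-- The Gleason part of `Φ`. -/
def gleasonPart (Φ : VectorSpectrum A B) : Set (VectorSpectrum A B) := {Ψ | gleasonDist Φ Ψ < 2}

/-- `Φ` is isolated (in the Gleason metric) if its Gleason part is a singleton. -/
def IsIsolated (Φ : VectorSpectrum A B) : Prop := gleasonPart Φ = {Φ}

end Spectrum

section AronBerner

variable {E : Type*} [NormedAddCommGroup E] [NormedSpace ℂ E]

/-- For `z` in the bidual of `E`, the value on the diagonal `(z, …, z)` of the Aron–Berner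
extension of a bounded `n`-linear form on `E`, as a functional of the form: each of the variables
is extended in turn by letting `z` act on the resulting bounded linear functional. -/
def aronBernerForm (z : StrongDual ℂ (StrongDual ℂ E)) :
    (n : ℕ) → StrongDual ℂ (ContinuousMultilinearMap ℂ (fun _ : Fin n => E) ℂ)
  | 0 => (continuousMultilinearCurryFin0 ℂ E ℂ).toContinuousLinearEquiv.toContinuousLinearMap
  | n + 1 =>
    z ∘L (ContinuousLinearMap.compL ℂ E
        (ContinuousMultilinearMap ℂ (fun _ : Fin n => E) ℂ) ℂ (aronBernerForm z n)) ∘L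
      (continuousMultilinearCurryLeftEquiv ℂ (fun _ : Fin (n + 1) => E)
        ℂ).toContinuousLinearEquiv.toContinuousLinearMap

/-- The Aron–Berner extension of a function on the open unit ball of `E` to the open unit ball of
the bidual: the terms of the Taylor series at the origin are extended and summed. -/
def aronBernerSeries (f : ball (0 : E) 1 → ℂ) (z : StrongDual ℂ (StrongDual ℂ E)) : ℂ :=
  ∑' n : ℕ, (n.factorial : ℂ)⁻¹ *
    aronBernerForm z n (iteratedFDeriv ℂ n (Function.extend Subtype.val f 0) (0 : E))

/-- The canonical extension to the closed unit ball of the bidual: the Aron–Berner extension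
on the open ball, extended by continuity to the unit sphere. -/
def canonicalExtension (f : ball (0 : E) 1 → ℂ) : StrongDual ℂ (StrongDual ℂ E) → ℂ :=
  extendFrom (ball 0 1) (aronBernerSeries f)

end AronBerner

/-- The space of complex null sequences with the supremum norm. -/
abbrev C0 : Type := C₀(ℕ, ℂ)

/-- The space of bounded complex sequences with the supremum norm. -/
abbrev LInfty : Type := lp (fun _ : ℕ => ℂ) ∞

/-- The `n`-th unit vector of `c₀`. -/
def unitVec (n : ℕ) : C0 where
  toFun := Pi.single n 1
  continuous_toFun := continuous_of_discreteTopology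
  zero_at_infty' := by
    rw [Filter.cocompact_eq_cofinite]
    refine tendsto_const_nhds.congr' ?_
    have : ∀ᶠ k : ℕ in Filter.cofinite, k ≠ n := by
      simp [Filter.eventually_cofinite]
    filter_upwards [this] with k hk
    simp [hk]

theorem sum_norm_apply_unitVec_le (φ : StrongDual ℂ C0) (s : Finset ℕ) :
    ∑ n ∈ s, ‖φ (unitVec n)‖ ≤ ‖φ‖ := by
  set c : ℕ → ℂ := fun n => conj (φ (unitVec n)) / (‖φ (unitVec n)‖ : ℂ) with hc
  have hc1 : ∀ n, ‖c n‖ ≤ 1 := by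
    intro n
    simp only [hc, norm_div, RCLike.norm_conj, Complex.norm_real, norm_norm]
    exact div_self_le_one _
  have hval : φ (∑ n ∈ s, c n • unitVec n) = ((∑ n ∈ s, ‖φ (unitVec n)‖ : ℝ) : ℂ) := by
    rw [map_sum, Complex.ofReal_sum]
    refine Finset.sum_congr rfl fun n _ => ?_
    rw [map_smul, smul_eq_mul, hc]
    by_cases h : φ (unitVec n) = 0
    · simp [h]
    · have h' : (‖φ (unitVec n)‖ : ℂ) ≠ 0 := by simpa using h
      rw [div_mul_eq_mul_div, div_eq_iff h', Complex.conj_mul', sq]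
  have hnorm : ‖∑ n ∈ s, c n • unitVec n‖ ≤ 1 := by
    rw [← ZeroAtInftyContinuousMap.norm_toBCF_eq_norm]
    refine (BoundedContinuousFunction.norm_le zero_le_one).2 fun k => ?_
    have hk : ∀ t : Finset ℕ, (∑ n ∈ t, c n • unitVec n : C0) k =
        ∑ n ∈ t, c n * (Pi.single n 1 : ℕ → ℂ) k := by
      intro t
      induction t using Finset.induction_on with
      | empty => simp
      | insert a t ha ih =>
        rw [Finset.sum_insert ha, Finset.sum_insert ha, ZeroAtInftyContinuousMap.add_apply, ih]
        rfl
    change ‖(∑ n ∈ s, c n • unitVec n : C0) k‖ ≤ 1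
    rw [hk]
    simp only [Pi.single_apply, mul_ite, mul_one, mul_zero, Finset.sum_ite_eq]
    split_ifs
    · exact hc1 k
    · simp
  calc ∑ n ∈ s, ‖φ (unitVec n)‖ = ‖φ (∑ n ∈ s, c n • unitVec n)‖ := by
        rw [hval, Complex.norm_real, Real.norm_of_nonneg (Finset.sum_nonneg fun _ _ => norm_nonneg _)]
    _ ≤ ‖φ‖ * ‖∑ n ∈ s, c n • unitVec n‖ := φ.le_opNorm _
    _ ≤ ‖φ‖ * 1 := by gcongr
    _ = ‖φ‖ := mul_one _

theorem summable_norm_apply_unitVec (φ : StrongDual ℂ C0) :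
    Summable fun n => ‖φ (unitVec n)‖ :=
  summable_of_sum_le (fun _ => norm_nonneg _) (sum_norm_apply_unitVec_le φ)

theorem norm_mul_apply_unitVec_le (z : LInfty) (φ : StrongDual ℂ C0) (n : ℕ) :
    ‖z n * φ (unitVec n)‖ ≤ ‖z‖ * ‖φ (unitVec n)‖ := by
  rw [norm_mul]
  gcongr
  exact lp.norm_apply_le_norm ENNReal.top_ne_zero z n

theorem summable_mul_apply_unitVec (z : LInfty) (φ : StrongDual ℂ C0) :
    Summable fun n => z n * φ (unitVec n) :=
  .of_norm_bounded ((summable_norm_apply_unitVec φ).mul_left ‖z‖)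
    (norm_mul_apply_unitVec_le z φ)

/-- The identification of `ℓ_∞` with the bidual of `c₀`: a bounded sequence `z` acts on a
functional `φ` of `c₀`, identified with the sequence `(φ (e_n))` of `ℓ_1`, by
`∑ z_n φ (e_n)`. -/
def toBidual (z : LInfty) : StrongDual ℂ (StrongDual ℂ C0) :=
  LinearMap.mkContinuous
    { toFun := fun φ : StrongDual ℂ C0 => ∑' n, z n * φ (unitVec n)
      map_add' := fun φ ψ => by
        simp only [add_apply, mul_add]
        exact (summable_mul_apply_unitVec z φ).tsum_add (summable_mul_apply_unitVec z ψ)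
      map_smul' := fun c φ => by
        simp only [smul_apply, smul_eq_mul, RingHom.id_apply, ← tsum_mul_left]
        exact tsum_congr fun n => by ring }
    ‖z‖ fun φ => by
      have h := (summable_norm_apply_unitVec φ).mul_left ‖z‖
      refine (tsum_of_norm_bounded h.hasSum (norm_mul_apply_unitVec_le z φ)).trans ?_
      rw [tsum_mul_left]
      gcongr
      exact (summable_norm_apply_unitVec φ).tsum_le_of_sum_le (sum_norm_apply_unitVec_le φ)

/-- The closed unit ball of the Banach space of bounded holomorphic functions from the open unit
ball of `c₀` to `ℓ_∞`, with the supremum norm. -/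
def closedUnitBallHInfty : Set (ball (0 : C0) 1 →ᵇ LInfty) := {g | IsHolomorphic g ∧ ‖g‖ ≤ 1}

theorem coord_mem_closedBall (g : closedUnitBallHInfty) (n : ℕ) (x : ball (0 : C0) 1) :
    (g.1 x : LInfty) n ∈ closedBall (0 : ℂ) 1 := by
  rw [mem_closedBall_zero_iff]
  exact (lp.norm_apply_le_norm ENNReal.top_ne_zero _ n).trans
    ((g.1.norm_coe_le_norm x).trans g.2.2)

/-- The `n`-th coordinate function `g_n` of an element `g = (g_n)` of the closed unit ball of
the space of bounded holomorphic functions from `B_{c₀}` to `ℓ_∞`. -/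
def coord (g : closedUnitBallHInfty) (n : ℕ) (x : ball (0 : C0) 1) : closedBall (0 : ℂ) 1 :=
  ⟨(g.1 x : LInfty) n, coord_mem_closedBall g n x⟩

/-- `Φ` is the composition homomorphism `C_g`, that is, `Φ f = f̃ ∘ g` for every `f`, where
`f̃` is the canonical extension of `f`. -/
def IsComposition (g : ball (0 : C0) 1 → LInfty) (Φ : VectorSpectrum (AUnif C0) (HInfty C0)) : Prop :=
  ∀ (f : AUnif C0) (x : ball (0 : C0) 1),
    (Φ f).1 x = canonicalExtension (f.1 : ball (0 : C0) 1 → ℂ) (toBidual (g x))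

/-- `Φ` is the composition homomorphism `C_u` on the disk algebra, that is, `Φ f = f ∘ u` for
every `f`. -/
def IsDiskComposition (u : ball (0 : C0) 1 → closedBall (0 : ℂ) 1)
    (Φ : VectorSpectrum DiskAlgebra (HInfty C0)) : Prop :=
  ∀ (f : DiskAlgebra) (x : ball (0 : C0) 1), (Φ f).1 x = f.1 (u x)

end PolydiskHom

end

open Metric Filter Topology
open scoped BoundedContinuousFunction ZeroAtInfty ENNReal ComplexConjugate

noncomputable section

namespace PolydiskHom

/-! ### Holomorphic maps between complex normed spaces: Cauchy estimates and smoothness. -/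

section Holomorphic

variable {E : Type*} [NormedAddCommGroup E] [NormedSpace ℂ E]
  {F : Type*} [NormedAddCommGroup F] [NormedSpace ℂ F]

/-! The coordinate functions generate a dense subalgebra of the uniformly continuous algebra on the
ball of `c₀`, so homomorphisms on it are compared one coordinate at a time. The disk algebra embeds
contractively as functions of the `n`-th coordinate (`diskInclusion`), and freezing the other
coordinates at a point of the closed ball of `ℓ_∞` gives a contractive left inverse (`sliceHom`).

If every `C_{g_n}` is isolated and `Ψ` lies in the Gleason part of `C_g`, restriction along
`diskInclusion n` cannot increase the distance, so `Ψ` and `C_g` agree on every coordinate function,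
hence everywhere by density (`isIsolated_compHom_of_forall`). Conversely, an element `Ψ` of the
Gleason part of `C_{g_n}` is composition with `u = Ψ(id)`. Replacing `g_n` by `u` in `g` gives a
composition homomorphism no farther from `C_g` than `Ψ` is from `C_{g_n}`, by slicing `f` separately
at each point `x`. Isolation of `C_g` then forces `u = g_n` (`isIsolated_of_isIsolated_compHom`).

Most of the work is analysis on `c₀`. Every bounded multilinear form on `c₀` is the norm limit of
its truncations to finitely many coordinates (`tendsto_compContinuousLinearMap_trunc`). This yields
the density (`exists_mem_adjoin_coordA_norm_sub_le`), and it identifies the Aron–Berner extension at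
`z` with the limit of `f` along the truncations of `z` (`tendsto_apply_aronBernerSeries`), so the
extension is multiplicative, contractive and uniformly continuous. -/

theorem norm_fderiv_le_of_forall_norm_le {f : E → F} {c : E} {R M : ℝ} (hR : 0 < R)
    (hd : DifferentiableOn ℂ f (ball c R)) (hM : ∀ z ∈ ball c R, ‖f z‖ ≤ M) :
    ‖fderiv ℂ f c‖ ≤ 2 * M / R := by
  refine Complex.norm_fderiv_le_div_of_mapsTo_ball hd (fun z hz => ?_) hR
  rw [mem_closedBall, dist_eq_norm]
  linarith [norm_sub_le (f z) (f c), hM z hz, hM c (mem_ball_self hR)]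

/-- Second-order Schwarz lemma: after subtracting its linear part, `f` stays within `4 * M` of `f c`
and differs from it by `o(‖z - c‖)`, which forces quadratic decay. -/
theorem norm_sub_sub_fderiv_le {f : E → F} {c z : E} {R M : ℝ} (hR : 0 < R)
    (hd : DifferentiableOn ℂ f (ball c R)) (hM : ∀ z ∈ ball c R, ‖f z‖ ≤ M)
    (hz : z ∈ ball c R) :
    ‖f z - f c - fderiv ℂ f c (z - c)‖ ≤ 4 * M * (‖z - c‖ / R) ^ 2 := by
  have hc : DifferentiableAt ℂ f c := hd.differentiableAt (ball_mem_nhds _ hR)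
  have key := Complex.dist_le_mul_div_pow_of_mapsTo_ball_of_isLittleO (n := 1) (R₂ := 4 * M)
    (f := fun w => f w - fderiv ℂ f c (w - c)) (c := c) (z := z) (R₁ := R) ?_ ?_ ?_ hz
  · simpa [dist_eq_norm, sub_right_comm] using key
  · exact hd.sub (by fun_prop)
  · intro w hw
    have h1 := norm_fderiv_le_of_forall_norm_le hR hd hM
    have h2 : ‖fderiv ℂ f c (w - c)‖ ≤ 2 * M := by
      calc ‖fderiv ℂ f c (w - c)‖ ≤ ‖fderiv ℂ f c‖ * ‖w - c‖ := ContinuousLinearMap.le_opNorm _ _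
        _ ≤ 2 * M / R * R := by
          have : ‖w - c‖ ≤ R := by
            rw [← dist_eq_norm]; exact (mem_ball.1 hw).le
          gcongr
          exact (norm_nonneg _).trans h1
        _ = 2 * M := by field_simp
    rw [mem_closedBall, dist_eq_norm]
    have h3 : f w - (fderiv ℂ f c) (w - c) - (f c - (fderiv ℂ f c) (c - c)) =
      f w - f c - fderiv ℂ f c (w - c) := by simp; abel
    rw [h3]
    linarith [norm_sub_le (f w - f c) (fderiv ℂ f c (w - c)), norm_sub_le (f w) (f c), hM w hw,
      hM c (mem_ball_self hR)]
  · have := hc.hasFDerivAt.isLittleO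
    simp only [pow_one, sub_self, map_zero, sub_zero]
    refine (this.norm_right).congr_left fun w => by abel

/-- Weierstrass's theorem: Cauchy estimates on balls of a fixed radius make the derivatives
uniformly Cauchy near each point. -/
theorem differentiableOn_of_tendstoUniformlyOn [CompleteSpace F] {f : ℕ → E → F} {g : E → F}
    {s : Set E} (hs : IsOpen s) (h : TendstoUniformlyOn f g atTop s)
    (hf : ∀ n, DifferentiableOn ℂ (f n) s) : DifferentiableOn ℂ g s := by
  intro x hx
  obtain ⟨r, hr, hrs⟩ : ∃ r > 0, ball x (2 * r) ⊆ s := by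
    obtain ⟨r, hr, h⟩ := Metric.isOpen_iff.1 hs x hx
    exact ⟨r / 2, by positivity, by simpa [mul_div_cancel₀] using h⟩
  have hsub : ∀ y ∈ ball x r, ball y r ⊆ s := fun y hy =>
    (ball_subset_ball' (by rw [mem_ball] at hy; linarith)).trans hrs
  have hu : UniformCauchySeqOn (fun n => fderiv ℂ (f n)) atTop (ball x r) := by
    rw [Metric.uniformCauchySeqOn_iff]
    intro ε hε
    obtain ⟨N, hN⟩ := Metric.uniformCauchySeqOn_iff.1 h.uniformCauchySeqOn (ε * r / 4)
      (by positivity)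
    refine ⟨N, fun m hm n hn y hy => ?_⟩
    have hd : ∀ k, DifferentiableAt ℂ (f k) y := fun k =>
      (hf k).differentiableAt (hs.mem_nhds (hsub y hy (mem_ball_self hr)))
    rw [dist_eq_norm, ← fderiv_sub (hd m) (hd n)]
    have := norm_fderiv_le_of_forall_norm_le (f := f m - f n) (c := y) (M := ε * r / 4) hr
      (((hf m).sub (hf n)).mono (hsub y hy)) fun z hz => by
        have := hN m hm n hn z (hsub y hy hz)
        rw [dist_eq_norm] at this
        exact this.le
    refine this.trans_lt ?_
    rw [div_lt_iff₀ hr]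
    nlinarith [mul_pos hε hr]
  have hlim : ∀ y ∈ ball x r, ∃ L, Tendsto (fun n => fderiv ℂ (f n) y) atTop (𝓝 L) := fun y hy =>
    cauchySeq_tendsto_of_complete (hu.cauchySeq hy)
  choose! L hL using hlim
  exact (hasFDerivAt_of_tendstoUniformlyOn isOpen_ball
    (hu.tendstoUniformlyOn_of_tendsto hL)
    (fun n y hy => ((hf n).differentiableAt
      (hs.mem_nhds (hsub y hy (mem_ball_self hr)))).hasFDerivAt)
    (fun y hy => h.tendsto_at (hsub y hy (mem_ball_self hr)))
    (mem_ball_self hr)).differentiableAt.differentiableWithinAt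

/-- For fixed `v`, the map `y ↦ f'(y) v` is a uniform limit of difference quotients, hence
holomorphic. Its quadratic remainder is bounded linearly in `‖v‖`, so the pointwise derivatives
assemble into a derivative in operator norm. -/
theorem differentiableAt_fderiv_of_norm_le [CompleteSpace F] {f : E → F} {x : E} {r M : ℝ}
    (hr : 0 < r) (hd : DifferentiableOn ℂ f (ball x (3 * r)))
    (hM : ∀ z ∈ ball x (3 * r), ‖f z‖ ≤ M) : DifferentiableAt ℂ (fderiv ℂ f) x := by
  have hsub : ∀ y ∈ ball x (2 * r), ball y r ⊆ ball x (3 * r) := fun y hy =>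
    ball_subset_ball' (by rw [mem_ball] at hy; linarith)
  have hM0 : 0 ≤ M := (norm_nonneg _).trans (hM x (mem_ball_self (by positivity)))
  have hbd : ∀ y ∈ ball x (2 * r), ‖fderiv ℂ f y‖ ≤ 2 * M / r := fun y hy =>
    norm_fderiv_le_of_forall_norm_le hr (hd.mono (hsub y hy)) fun z hz => hM z (hsub y hy hz)
  have hv : ∀ v : E, DifferentiableOn ℂ (fun y => fderiv ℂ f y v) (ball x r) := by
    intro v
    have hp : (0 : ℝ) < ‖v‖ + 1 := by positivity
    -- Step sizes tending to `0` with `t n * ‖v‖ < r`, so that `y + t n • v` stays where the bound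
    -- `M` is available.
    set t : ℕ → ℝ := fun n => r / (‖v‖ + 1) * (1 / ((n : ℝ) + 1)) with ht
    have ht0 : ∀ n, 0 < t n := fun n => by positivity
    have htr : ∀ n, t n * ‖v‖ < r := by
      intro n
      have h1 : 1 / ((n : ℝ) + 1) ≤ 1 := by
        rw [div_le_one (by positivity)]; linarith [(Nat.cast_nonneg n : (0 : ℝ) ≤ n)]
      calc t n * ‖v‖ ≤ r / (‖v‖ + 1) * 1 * ‖v‖ := by simp only [ht]; gcongr
        _ = r * (‖v‖ / (‖v‖ + 1)) := by ring
        _ < r * 1 := by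
          gcongr
          rw [div_lt_one hp]; linarith
        _ = r := mul_one r
    have htl : Tendsto t atTop (𝓝 0) := by
      have := tendsto_one_div_add_atTop_nhds_zero_nat (𝕜 := ℝ)
      simpa [ht] using this.const_mul (r / (‖v‖ + 1))
    have hnorm : ∀ n, ‖(t n : ℂ) • v‖ = t n * ‖v‖ := fun n => by
      rw [norm_smul, Complex.norm_real, Real.norm_of_nonneg (ht0 n).le]
    refine differentiableOn_of_tendstoUniformlyOn isOpen_ball
      (f := fun n y => (t n : ℂ)⁻¹ • (f (y + (t n : ℂ) • v) - f y)) ?_ ?_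
    · rw [Metric.tendstoUniformlyOn_iff]
      intro ε hε
      have hl : Tendsto (fun n => 4 * M * (‖v‖ / r) ^ 2 * t n) atTop (𝓝 0) := by
        simpa using htl.const_mul (4 * M * (‖v‖ / r) ^ 2)
      filter_upwards [hl.eventually_lt_const hε] with n hn y hy
      have hy2 : y ∈ ball x (2 * r) := ball_subset_ball (by linarith) hy
      have key := norm_sub_sub_fderiv_le (f := f) (c := y) (z := y + (t n : ℂ) • v) (M := M) hr
        (hd.mono (hsub y hy2)) (fun z hz => hM z (hsub y hy2 hz)) (by
          rw [mem_ball, dist_eq_norm, add_sub_cancel_left, hnorm]; exact htr n)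
      rw [add_sub_cancel_left, map_smul, hnorm] at key
      have hne : (t n : ℂ) ≠ 0 := by exact_mod_cast (ht0 n).ne'
      have heq : (fderiv ℂ f y) v - (t n : ℂ)⁻¹ • (f (y + (t n : ℂ) • v) - f y) =
          -((t n : ℂ)⁻¹ • (f (y + (t n : ℂ) • v) - f y - (t n : ℂ) • fderiv ℂ f y v)) := by
        simp only [smul_sub, smul_smul, inv_mul_cancel₀ hne, one_smul]; abel
      rw [dist_eq_norm, heq, norm_neg, norm_smul, norm_inv, Complex.norm_real,
        Real.norm_of_nonneg (ht0 n).le]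
      calc (t n)⁻¹ * _ ≤ (t n)⁻¹ * (4 * M * (t n * ‖v‖ / r) ^ 2) := by
            gcongr
        _ = 4 * M * (‖v‖ / r) ^ 2 * t n := by
            have := (ht0 n).ne'
            field_simp
        _ < ε := hn
    · intro n
      refine DifferentiableOn.const_smul (DifferentiableOn.sub ?_ (hd.mono
        (ball_subset_ball (by linarith)))) _
      refine hd.comp (by fun_prop) fun y hy => ?_
      rw [mem_ball, dist_eq_norm] at hy ⊢
      calc ‖y + (t n : ℂ) • v - x‖ = ‖(y - x) + (t n : ℂ) • v‖ := by congr 1; abel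
        _ ≤ ‖y - x‖ + t n * ‖v‖ := (norm_add_le _ _).trans (by rw [hnorm])
        _ < 3 * r := by linarith [htr n]
  have hbv : ∀ v, ∀ y ∈ ball x r, ‖fderiv ℂ f y v‖ ≤ 2 * M / r * ‖v‖ := fun v y hy =>
    (ContinuousLinearMap.le_opNorm _ _).trans (by
      gcongr; exact hbd y (ball_subset_ball (by linarith) hy))
  have hva : ∀ v, DifferentiableAt ℂ (fun y => fderiv ℂ f y v) x := fun v =>
    (hv v).differentiableAt (ball_mem_nhds _ hr)
  let D : E →L[ℂ] E →L[ℂ] F := LinearMap.mkContinuous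
    { toFun := fun v => fderiv ℂ (fun y => fderiv ℂ f y v) x
      map_add' := fun v w => by
        simp only [map_add]
        exact fderiv_fun_add (hva v) (hva w)
      map_smul' := fun c v => by
        simp only [map_smul, RingHom.id_apply]
        exact fderiv_fun_const_smul (hva v) c }
    (2 * (2 * M / r) / r) fun v => by
      refine (norm_fderiv_le_of_forall_norm_le hr (hv v) (hbv v)).trans_eq ?_
      ring
  refine HasFDerivAt.differentiableAt (f' := D.flip) ?_
  rw [hasFDerivAt_iff_isLittleO]
  have hO : (fun y => fderiv ℂ f y - fderiv ℂ f x - D.flip (y - x)) =O[𝓝 x]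
      fun y => ‖y - x‖ ^ 2 := by
    refine Asymptotics.IsBigO.of_bound (4 * (2 * M / r) / r ^ 2) ?_
    filter_upwards [ball_mem_nhds x hr] with y hy
    refine ContinuousLinearMap.opNorm_le_bound _ (by positivity) fun v => ?_
    refine (norm_sub_sub_fderiv_le hr (hv v) (hbv v) hy).trans_eq ?_
    rw [Real.norm_of_nonneg (by positivity)]
    ring
  refine hO.trans_isLittleO ?_
  have h2 : (fun y : E => ‖y - x‖ ^ 2) = fun y => ‖y - x‖ * ‖y - x‖ := by ext; ring
  rw [h2]
  have h3 : (fun y : E => ‖y - x‖) =o[𝓝 x] (fun _ => (1 : ℝ)) := by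
    rw [Asymptotics.isLittleO_one_iff]
    have : Continuous fun y : E => ‖y - x‖ := by fun_prop
    simpa using this.tendsto x
  have h4 := h3.mul_isBigO (Asymptotics.isBigO_refl (fun y : E => ‖y - x‖) (𝓝 x))
  simp only [one_mul] at h4
  exact h4.trans_isBigO (Asymptotics.isBigO_norm_left.2 (Asymptotics.isBigO_refl _ _))

theorem differentiableOn_fderiv [CompleteSpace F] {f : E → F} {s : Set E} (hs : IsOpen s)
    (hd : DifferentiableOn ℂ f s) : DifferentiableOn ℂ (fderiv ℂ f) s := by
  intro x hx
  have hc : ContinuousAt f x := (hd.differentiableAt (hs.mem_nhds hx)).continuousAt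
  have h1 : ∀ᶠ y in 𝓝 x, ‖f y‖ ≤ ‖f x‖ + 1 :=
    (hc.norm.eventually_lt_const (lt_add_one _)).mono fun y hy => hy.le
  obtain ⟨r, hr, h⟩ := Metric.mem_nhds_iff.1 (inter_mem h1 (hs.mem_nhds hx))
  have h3 : 3 * (r / 3) = r := by ring
  exact (differentiableAt_fderiv_of_norm_le (r := r / 3) (M := ‖f x‖ + 1) (by positivity)
    (by rw [h3]; exact hd.mono fun y hy => (h hy).2)
    (by rw [h3]; exact fun y hy => (h hy).1)).differentiableWithinAt

end Holomorphic

theorem contDiffOn_of_differentiableOn_complex (n : ℕ) {E : Type} [NormedAddCommGroup E]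
    [NormedSpace ℂ E] {F : Type} [NormedAddCommGroup F] [NormedSpace ℂ F] [CompleteSpace F]
    {f : E → F} {s : Set E} (hs : IsOpen s) (hd : DifferentiableOn ℂ f s) :
    ContDiffOn ℂ n f s := by
  induction n generalizing F with
  | zero => exact contDiffOn_zero.2 hd.continuousOn
  | succ n ih =>
    push_cast
    refine (contDiffOn_succ_iff_fderiv_of_isOpen hs).2 ⟨hd, by simp, ?_⟩
    exact ih (differentiableOn_fderiv hs hd)

/-- Restriction to the complex line through `x` reduces Taylor expansion in `E` to one variable. -/
theorem iteratedFDeriv_apply_diag {E : Type} [NormedAddCommGroup E] [NormedSpace ℂ E]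
    {G : E → ℂ} {s : Set E} (hs : IsOpen s) (h0 : (0 : E) ∈ s) (hd : DifferentiableOn ℂ G s)
    (n : ℕ) (x : E) :
    iteratedFDeriv ℂ n G 0 (fun _ => x) = iteratedDeriv n (fun t : ℂ => G (t • x)) 0 := by
  set L : ℂ →L[ℂ] E := ContinuousLinearMap.toSpanSingleton ℂ x with hL
  have hLs : IsOpen (L ⁻¹' s) := hs.preimage L.continuous
  have h1 := L.iteratedFDerivWithin_comp_right (x := 0) (i := n)
    (contDiffOn_of_differentiableOn_complex n hs hd) hs.uniqueDiffOn hLs.uniqueDiffOn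
    (by simpa using h0) le_rfl
  rw [iteratedFDerivWithin_of_isOpen n hLs (by simpa using h0),
    iteratedFDerivWithin_of_isOpen n hs (by simpa using h0), map_zero] at h1
  have h2 : (fun t : ℂ => G (t • x)) = G ∘ L := by ext t; simp [hL]
  rw [iteratedDeriv_eq_iteratedFDeriv, h2, h1]
  simp [hL]

/-! ### Taylor series at the origin. -/

section Taylor

variable {E : Type} [NormedAddCommGroup E] [NormedSpace ℂ E] {G : E → ℂ}

theorem differentiableOn_smul_line (hd : DifferentiableOn ℂ G (ball 0 1)) {x : E} {r : ℝ}
    (hr : r * ‖x‖ < 1) :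
    DifferentiableOn ℂ (fun t : ℂ => G (t • x)) (closedBall 0 r) := by
  refine hd.comp (by fun_prop) fun t ht => ?_
  rw [mem_closedBall_zero_iff] at ht
  rw [mem_ball_zero_iff, norm_smul]
  exact (mul_le_mul_of_nonneg_right ht (norm_nonneg x)).trans_lt hr

/-- Cauchy's estimate for `t ↦ G (t • x)` on the circle of radius `ρ⁻¹`, which stays in the unit
ball because `‖x‖ < ρ`. -/
theorem norm_iteratedFDeriv_apply_diag_le (hd : DifferentiableOn ℂ G (ball 0 1)) {M : ℝ}
    (hM : ∀ x ∈ ball (0 : E) 1, ‖G x‖ ≤ M) {x : E} {ρ : ℝ} (hx : ‖x‖ < ρ) (n : ℕ) :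
    ‖(n.factorial : ℂ)⁻¹ * iteratedFDeriv ℂ n G 0 (fun _ => x)‖ ≤ M * ρ ^ n := by
  have hρ : 0 < ρ := (norm_nonneg x).trans_lt hx
  have hx' : ρ⁻¹ * ‖x‖ < 1 := by rw [inv_mul_lt_iff₀ hρ]; simpa using hx
  rw [iteratedFDeriv_apply_diag isOpen_ball (mem_ball_self one_pos) hd]
  have := Complex.norm_iteratedDeriv_le_of_forall_mem_sphere_norm_le (n := n) (c := 0) (R := ρ⁻¹)
    (C := M) (f := fun t : ℂ => G (t • x)) (by positivity)
    (DifferentiableOn.diffContOnCl ((differentiableOn_smul_line hd hx').mono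
      closure_ball_subset_closedBall)) (fun z hz => hM _ (by
        rw [mem_sphere_zero_iff_norm] at hz
        rw [mem_ball_zero_iff, norm_smul, hz]
        exact hx'))
  rw [norm_mul, norm_inv, Complex.norm_natCast, inv_mul_le_iff₀ (by positivity)]
  refine this.trans_eq ?_
  rw [inv_pow, div_inv_eq_mul]
  ring

theorem hasSum_iteratedFDeriv_apply_diag (hd : DifferentiableOn ℂ G (ball 0 1)) {x : E}
    (hx : ‖x‖ < 1) :
    HasSum (fun n : ℕ => (n.factorial : ℂ)⁻¹ * iteratedFDeriv ℂ n G 0 (fun _ => x)) (G x) := by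
  obtain ⟨ρ, hxρ, hρ⟩ := exists_between hx
  have hρ0 : 0 < ρ := (norm_nonneg x).trans_lt hxρ
  have hx' : ρ⁻¹ * ‖x‖ < 1 := by rw [inv_mul_lt_iff₀ hρ0]; simpa using hxρ
  have := Complex.hasSum_taylorSeries_on_ball (c := 0) (r := ρ⁻¹) (z := 1)
    ((differentiableOn_smul_line hd hx').mono ball_subset_closedBall)
    (by simpa using (one_lt_inv₀ hρ0).2 hρ)
  simp only [sub_zero, one_pow, smul_eq_mul, one_mul, one_smul] at this
  simpa only [iteratedFDeriv_apply_diag isOpen_ball (mem_ball_self one_pos) hd] using this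

end Taylor

/-! ### Closedness under uniform limits, giving the completeness behind automatic contractivity of
characters. -/

section Closed

theorem extend_apply_ball {E : Type*} [NormedAddCommGroup E] {F : Type*} [Zero F] (f : ball (0 : E) 1 → F) {x : E}
    (hx : x ∈ ball (0 : E) 1) : Function.extend Subtype.val f 0 x = f ⟨x, hx⟩ :=
  Subtype.val_injective.extend_apply f 0 ⟨x, hx⟩

variable {E : Type*} [NormedAddCommGroup E] [NormedSpace ℂ E]

theorem isHolomorphic_of_tendstoUniformly {f : ℕ → ball (0 : E) 1 → ℂ} {g : ball (0 : E) 1 → ℂ}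
    (hf : ∀ n, IsHolomorphic (f n)) (h : TendstoUniformly f g atTop) : IsHolomorphic g := by
  refine differentiableOn_of_tendstoUniformlyOn isOpen_ball
    (f := fun n => Function.extend Subtype.val (f n) 0) ?_ hf
  rw [Metric.tendstoUniformlyOn_iff]
  intro ε hε
  filter_upwards [Metric.tendstoUniformly_iff.1 h ε hε] with n hn x hx
  rw [extend_apply_ball _ hx, extend_apply_ball _ hx]
  exact hn _

theorem isClosed_AUnif : IsClosed (AUnif E : Set (ball (0 : E) 1 →ᵇ ℂ)) := by
  refine IsSeqClosed.isClosed fun f g hf hfg => ?_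
  have h := BoundedContinuousFunction.tendsto_iff_tendstoUniformly.1 hfg
  exact ⟨isHolomorphic_of_tendstoUniformly (fun n => (hf n).1) h,
    h.uniformContinuous (.of_forall fun n => (hf n).2)⟩

theorem isClosed_DiskAlgebra : IsClosed (DiskAlgebra : Set C(closedBall (0 : ℂ) 1, ℂ)) := by
  refine IsSeqClosed.isClosed fun f g hf hfg => ?_
  have h := ContinuousMap.tendsto_iff_tendstoUniformly.1 hfg
  exact isHolomorphic_of_tendstoUniformly hf (h.comp fun z : ball (0 : ℂ) 1 =>
    (⟨z, ball_subset_closedBall z.2⟩ : closedBall (0 : ℂ) 1))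

instance : CompleteSpace (AUnif E) := isClosed_AUnif.completeSpace_coe

instance : CompleteSpace DiskAlgebra := isClosed_DiskAlgebra.completeSpace_coe

end Closed


/-! ### Diagonal sums of multilinear forms. -/

section Diagonal

theorem map_update_sum_smul {ι : Type*} [DecidableEq ι] {E : Type*} [NormedAddCommGroup E]
    [NormedSpace ℂ E] {κ : Type*} [Fintype κ]
    (A : ContinuousMultilinearMap ℂ (fun _ : ι => E) ℂ) (c : ι → E) (i : ι) (b : κ → ℂ)
    (y : κ → E) :
    A (Function.update c i (∑ k, b k • y k)) = ∑ k, b k * A (Function.update c i (y k)) := by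
  refine (A.toMultilinearMap.map_update_sum Finset.univ i _ c).trans
    (Finset.sum_congr rfl fun k _ => ?_)
  exact A.map_update_smul c i (b k) (y k)

variable {ι : Type*} [Fintype ι] [DecidableEq ι] {E : Type*} [NormedAddCommGroup E]
  [NormedSpace ℂ E]

/-- Orthogonality of the characters of `ZMod J`: averaging over `s` kills the off-diagonal terms. -/
theorem sum_sum_stdAddChar (J : ℕ) [NeZero J] (a : ZMod J → ZMod J → ℂ) :
    ∑ s : ZMod J, ∑ j, ∑ k, ZMod.stdAddChar (s * j) * (ZMod.stdAddChar (-(s * k)) * a j k) =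
      J * ∑ j, a j j := by
  rw [Finset.sum_comm, Finset.mul_sum]
  refine Finset.sum_congr rfl fun j _ => ?_
  rw [Finset.sum_comm]
  have h : ∀ k, ∑ s : ZMod J, ZMod.stdAddChar (s * j) * (ZMod.stdAddChar (-(s * k)) * a j k) =
      (if j - k = 0 then (J : ℂ) else 0) * a j k := by
    intro k
    have := AddChar.sum_mulShift (j - k) (ZMod.isPrimitive_stdAddChar J)
    rw [ZMod.card] at this
    rw [apply_ite (Nat.cast : ℕ → ℂ)] at this
    simp only [Nat.cast_zero] at this
    rw [← this, Finset.sum_mul]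
    refine Finset.sum_congr rfl fun s _ => ?_
    rw [← mul_assoc, ← AddChar.map_add_eq_mul]
    congr 2
    ring
  simp only [h, sub_eq_zero, ite_mul, zero_mul, Finset.sum_ite_eq, Finset.mem_univ, if_true]

/-- The bound does not depend on the number `J` of terms. A single varying slot is handled by
linearity. To add a slot `i`, the vector `∑ k, χ(-sk) • y i k` of norm at most `C` is put there and
`θ j` is twisted by `χ(sj)`; the average over `s` recovers the diagonal. -/
theorem norm_sum_diagonal_le {J : ℕ} [NeZero J]
    (A : ContinuousMultilinearMap ℂ (fun _ : ι => E) ℂ) {C : ℝ} (y : ι → ZMod J → E)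
    (V : Finset ι) (hV : V.Nonempty)
    (hy : ∀ i ∈ V, ∀ a : ZMod J → ℂ, (∀ j, ‖a j‖ ≤ 1) → ‖∑ j, a j • y i j‖ ≤ C) :
    ∀ c : ι → E, (∀ i, ‖c i‖ ≤ C) → ∀ θ : ZMod J → ℂ, (∀ j, ‖θ j‖ ≤ 1) →
      ‖∑ j, θ j * A (fun i => if i ∈ V then y i j else c i)‖ ≤ ‖A‖ * C ^ Fintype.card ι := by
  induction hV using Finset.Nonempty.cons_induction with
  | singleton i₀ =>
    intro c hc θ hθ
    have h1 : ∀ j, (fun i => if i ∈ ({i₀} : Finset ι) then y i j else c i) =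
        Function.update c i₀ (y i₀ j) := by
      intro j; ext i
      by_cases h : i = i₀
      · subst h; simp
      · simp [h]
    have h2 : ∑ j, θ j * A (fun i => if i ∈ ({i₀} : Finset ι) then y i j else c i) =
        A (Function.update c i₀ (∑ j, θ j • y i₀ j)) := by
      rw [map_update_sum_smul]
      exact Finset.sum_congr rfl fun j _ => by rw [h1]
    rw [h2]
    refine A.le_opNorm_mul_pow_card_of_le ?_
    rw [pi_norm_le_iff_of_nonneg ((norm_nonneg _).trans (hc i₀))]
    intro i
    by_cases h : i = i₀
    · subst h
      simpa using hy i (by simp) θ hθ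
    · simpa [h] using hc i
  | cons i V hiV hV ih =>
    intro c hc θ hθ
    have hJ : (0 : ℝ) < J := by exact_mod_cast Nat.pos_of_ne_zero (NeZero.ne J)
    set w : ZMod J → ZMod J → ℂ := fun j k =>
      A (fun i' => if i' ∈ V then y i' j else Function.update c i (y i k) i') with hw
    have hdiag : ∀ j, A (fun i' => if i' ∈ Finset.cons i V hiV then y i' j else c i') = w j j := by
      intro j
      simp only [hw]
      congr 1
      ext i'
      by_cases h : i' = i
      · subst h; simp [hiV]
      · simp [h]
    have hexp : ∀ (b : ZMod J → ℂ) j, A (fun i' => if i' ∈ V then y i' j else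
        Function.update c i (∑ k, b k • y i k) i') = ∑ k, b k * w j k := by
      intro b j
      have hupd : ∀ v : E, (fun i' => if i' ∈ V then y i' j else Function.update c i v i') =
          Function.update (fun i' => if i' ∈ V then y i' j else c i') i v := by
        intro v; ext i'
        by_cases h : i' = i
        · subst h; simp [hiV]
        · simp [h]
      rw [hupd, map_update_sum_smul]
      simp only [hw, hupd]
    have hψ : ∀ x : ZMod J, ‖(ZMod.stdAddChar x : ℂ)‖ = 1 := fun x => AddChar.norm_apply _ x
    have hbound : ∀ s : ZMod J, ‖∑ j, ∑ k, ZMod.stdAddChar (s * j) *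
        (ZMod.stdAddChar (-(s * k)) * (θ j * w j k))‖ ≤ ‖A‖ * C ^ Fintype.card ι := by
      intro s
      have := ih (fun i' hi' => hy i' (Finset.mem_cons_of_mem hi'))
        (Function.update c i (∑ k, ZMod.stdAddChar (-(s * k)) • y i k)) ?_
        (fun j => θ j * ZMod.stdAddChar (s * j)) ?_
      · refine le_trans (le_of_eq ?_) this
        congr 1
        refine Finset.sum_congr rfl fun j _ => ?_
        rw [hexp, Finset.mul_sum]
        exact Finset.sum_congr rfl fun k _ => by ring
      · intro i'
        by_cases h : i' = i
        · subst h
          simpa using hy i' (Finset.mem_cons_self _ _) (fun k => ZMod.stdAddChar (-(s * k)))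
            fun k => (hψ _).le
        · simpa [h] using hc i'
      · intro j
        rw [norm_mul, hψ, mul_one]
        exact hθ j
    have h1 := sum_sum_stdAddChar J fun j k => θ j * w j k
    have h2 : ‖(J : ℂ) * ∑ j, θ j * w j j‖ ≤ J * (‖A‖ * C ^ Fintype.card ι) := by
      rw [← h1]
      refine (norm_sum_le _ _).trans ((Finset.sum_le_sum fun s _ => hbound s).trans_eq ?_)
      simp [ZMod.card]
    rw [norm_mul, Complex.norm_natCast] at h2
    simp only [hdiag]
    exact le_of_mul_le_mul_left h2 hJ

theorem exists_norm_le_one_mul_eq_norm (a : ℂ) : ∃ θ : ℂ, ‖θ‖ ≤ 1 ∧ θ * a = ‖a‖ := by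
  refine ⟨conj a / ‖a‖, ?_, ?_⟩
  · simp only [norm_div, RCLike.norm_conj, Complex.norm_real, norm_norm]
    exact div_self_le_one _
  · by_cases h : a = 0
    · simp [h]
    · have h' : (‖a‖ : ℂ) ≠ 0 := by simpa using h
      rw [div_mul_eq_mul_div, div_eq_iff h', Complex.conj_mul', sq]

end Diagonal

/-! ### Multilinear forms along coordinatewise convergent sequences in `c₀`. -/

section NullSequences

theorem norm_coord_le (x : C0) (m : ℕ) : ‖x m‖ ≤ ‖x‖ := by
  rw [← ZeroAtInftyContinuousMap.norm_toBCF_eq_norm]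
  exact x.toBCF.norm_coe_le_norm m

theorem norm_le_of_forall_coord {x : C0} {C : ℝ} (hC : 0 ≤ C) (h : ∀ m, ‖x m‖ ≤ C) : ‖x‖ ≤ C := by
  rw [← ZeroAtInftyContinuousMap.norm_toBCF_eq_norm]
  exact (BoundedContinuousFunction.norm_le hC).2 h

/-- The `m`-th coordinate functional of `c₀`. -/
def coordCLM (m : ℕ) : StrongDual ℂ C0 :=
  LinearMap.mkContinuous
    { toFun := fun x : C0 => x m
      map_add' := fun _ _ => rfl
      map_smul' := fun _ _ => rfl } 1 fun x => by simpa using norm_coord_le x m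

@[simp]
theorem coordCLM_apply (m : ℕ) (x : C0) : coordCLM m x = x m := rfl

theorem norm_coordCLM_le (m : ℕ) : ‖coordCLM m‖ ≤ 1 :=
  LinearMap.mkContinuous_norm_le _ zero_le_one _

theorem unitVec_apply (k m : ℕ) : unitVec k m = if m = k then 1 else 0 := Pi.single_apply k 1 m

theorem tendsto_coord_atTop (x : C0) : Tendsto (fun m => x m) atTop (𝓝 0) := by
  have := x.zero_at_infty'
  rwa [Filter.cocompact_eq_cofinite, Nat.cofinite_eq_atTop] at this

/-- Coordinatewise convergence to `0` of a sequence in `c₀`. -/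
def CoordNull (x : ℕ → C0) : Prop := ∀ m, Tendsto (fun k => x k m) atTop (𝓝 0)

/-- Coordinatewise convergence of a sequence in `c₀`. -/
def CoordConv (x : ℕ → C0) : Prop := ∃ z : ℕ → ℂ, ∀ m, Tendsto (fun k => x k m) atTop (𝓝 (z m))

theorem CoordNull.comp {x : ℕ → C0} (h : CoordNull x) {φ : ℕ → ℕ} (hφ : Tendsto φ atTop atTop) :
    CoordNull fun k => x (φ k) := fun m => (h m).comp hφ

theorem CoordConv.comp {x : ℕ → C0} (h : CoordConv x) {φ : ℕ → ℕ} (hφ : Tendsto φ atTop atTop) :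
    CoordConv fun k => x (φ k) := by
  obtain ⟨z, hz⟩ := h
  exact ⟨z, fun m => (hz m).comp hφ⟩

/-- Gliding hump. Beyond some `M` the vectors already chosen contribute less than `δ`; the next one
is chosen to be below `δ` on the coordinates before `M`. Each coordinate thus meets at most one
large entry. -/
theorem exists_sum_norm_coord_le {ι : Type*} {x : ι → ℕ → C0} {R δ : ℝ} (hR : ∀ i k, ‖x i k‖ ≤ R) (hR0 : 0 ≤ R)
    (hδ : 0 < δ) (U : Finset ι) (hU : ∀ i ∈ U, CoordNull (x i)) {p : ℕ → Prop}
    (hp : ∃ᶠ k in atTop, p k) (J : ℕ) :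
    ∃ κ : ℕ → ℕ, (∀ j, p (κ j)) ∧
      ∀ i ∈ U, ∀ m, ∑ j ∈ Finset.range J, ‖x i (κ j) m‖ ≤ R + J * δ := by
  induction J with
  | zero =>
    obtain ⟨k, hk⟩ := hp.exists
    exact ⟨fun _ => k, fun _ => hk, fun i _ m => by simpa using hR0⟩
  | succ J ih =>
    obtain ⟨κ, hκ, hs⟩ := ih
    have hlim : ∀ i, Tendsto (fun m => ∑ j ∈ Finset.range J, ‖x i (κ j) m‖) atTop (𝓝 0) := by
      intro i
      simpa using tendsto_finsetSum (Finset.range J) fun j _ =>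
        (tendsto_coord_atTop (x i (κ j))).norm
    have hev : ∀ᶠ m in atTop, ∀ i ∈ U, ∑ j ∈ Finset.range J, ‖x i (κ j) m‖ < δ :=
      (Finset.eventually_all U).2 fun i _ => (hlim i).eventually_lt_const hδ
    obtain ⟨M, hM⟩ := eventually_atTop.1 hev
    have hev2 : ∀ᶠ k in atTop, ∀ i ∈ U, ∀ m ∈ Finset.range M, ‖x i k m‖ < δ :=
      (Finset.eventually_all U).2 fun i hi => (Finset.eventually_all _).2 fun m _ => by
        have := (hU i hi m).norm
        rw [norm_zero] at this
        exact this.eventually_lt_const hδ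
    obtain ⟨k, hpk, hk⟩ := (hp.and_eventually hev2).exists
    refine ⟨Function.update κ J k, fun j => ?_, fun i hi m => ?_⟩
    · by_cases h : j = J
      · subst h; simpa using hpk
      · simpa [h] using hκ j
    · rw [Finset.sum_range_succ, Function.update_self]
      have : ∑ j ∈ Finset.range J, ‖x i (Function.update κ J k j) m‖ =
          ∑ j ∈ Finset.range J, ‖x i (κ j) m‖ :=
        Finset.sum_congr rfl fun j hj => by
          rw [Function.update_of_ne (Finset.mem_range.1 hj).ne]
      rw [this]
      push_cast
      rcases lt_or_ge m M with h | h
      · linarith [hs i hi m, hk i hi m (Finset.mem_range.2 h)]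
      · have h1 := hM m h i hi
        have h2 := (norm_coord_le (x i k) m).trans (hR i k)
        have h3 : (0 : ℝ) ≤ J * δ := by positivity
        linarith

variable {ι : Type*} [Fintype ι] [DecidableEq ι]

/-- If `‖A (x k)‖ ≥ ε` infinitely often, the gliding hump selects `n + 1` such indices to which the
diagonal bound applies with `C = R + 1`. Then `(n + 1) * ε ≤ ‖A‖ * (R + 1) ^ card ι`, which fails
for large `n`. -/
theorem tendsto_zero_of_coordNull (A : ContinuousMultilinearMap ℂ (fun _ : ι => C0) ℂ)
    {x : ι → ℕ → C0} {R : ℝ} (hR : ∀ i k, ‖x i k‖ ≤ R) (U : Finset ι) (hU : U.Nonempty)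
    (hnull : ∀ i ∈ U, CoordNull (x i)) (hconst : ∀ i ∉ U, ∃ c, ∀ k, x i k = c) :
    Tendsto (fun k => A fun i => x i k) atTop (𝓝 0) := by
  by_contra hcon
  obtain ⟨i₀, -⟩ := id hU
  have hR0 : 0 ≤ R := (norm_nonneg _).trans (hR i₀ 0)
  rw [Metric.tendsto_atTop] at hcon
  push Not at hcon
  obtain ⟨ε, hε, hcon⟩ := hcon
  have hfreq : ∃ᶠ k in atTop, ε ≤ ‖A fun i => x i k‖ :=
    Filter.frequently_atTop.2 fun N => by simpa [dist_zero_right] using hcon N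
  obtain ⟨n, hn⟩ := exists_nat_gt (‖A‖ * (R + 1) ^ Fintype.card ι / ε)
  have hJ : (0 : ℝ) < (n + 1 : ℕ) := by positivity
  -- This `δ` makes the accumulated error `J * δ` equal to `1`, uniformly in the number of terms.
  obtain ⟨κ, hκ, hs⟩ := exists_sum_norm_coord_le hR hR0 (δ := 1 / (n + 1 : ℕ)) (by positivity) U
    hnull hfreq (n + 1)
  rw [mul_one_div_cancel hJ.ne'] at hs
  choose θ hθ hθa using fun j : ZMod (n + 1) =>
    exists_norm_le_one_mul_eq_norm (A fun i => x i (κ (ZMod.val j)))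
  have key := norm_sum_diagonal_le A (C := R + 1) (fun i (j : ZMod (n + 1)) => x i (κ (ZMod.val j))) U hU
    (fun i hi a ha => ?_) (fun i => x i 0) (fun i => (hR i 0).trans (by linarith)) θ hθ
  · have h1 : ∀ j : ZMod (n + 1), (fun i => if i ∈ U then x i (κ (ZMod.val j)) else x i 0) =
        fun i => x i (κ (ZMod.val j)) := by
      intro j; ext1 i
      by_cases h : i ∈ U
      · simp [h]
      · obtain ⟨c, hc⟩ := hconst i h
        simp [h, hc]
    simp only [h1, hθa] at key
    rw [← Complex.ofReal_sum, Complex.norm_real, Real.norm_of_nonneg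
      (Finset.sum_nonneg fun _ _ => norm_nonneg _)] at key
    have h2 : ∑ _j : ZMod (n + 1), ε ≤
        ∑ j : ZMod (n + 1), ‖A fun i => x i (κ (ZMod.val j))‖ :=
      Finset.sum_le_sum fun j _ => hκ _
    rw [Finset.sum_const, Finset.card_univ, ZMod.card, nsmul_eq_mul] at h2
    rw [div_lt_iff₀ hε] at hn
    push_cast at h2
    nlinarith
  · refine norm_le_of_forall_coord (by linarith) fun m => ?_
    rw [← coordCLM_apply, map_sum]
    calc ‖∑ j, coordCLM m (a j • x i (κ (ZMod.val j)))‖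
        ≤ ∑ j : ZMod (n + 1), ‖x i (κ (ZMod.val j)) m‖ := norm_sum_le_of_le _ fun j _ => by
          rw [map_smul, norm_smul, coordCLM_apply]
          exact mul_le_of_le_one_left (norm_nonneg _) (ha j)
      _ = ∑ j ∈ Finset.range (n + 1), ‖x i (κ j) m‖ := by
          rw [Finset.sum_range]
          rfl
      _ ≤ R + 1 := hs i hi m

/-- The coordinatewise limits in the slots of `T` need not lie in `c₀`, so they cannot be
subtracted. Instead, along a fast subsequence, a convergent slot is split into a difference of
consecutive terms, which is coordinatewise null, and the earlier term. -/
theorem tendsto_zero_of_coordConv (A : ContinuousMultilinearMap ℂ (fun _ : ι => C0) ℂ)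
    (T : Finset ι) : ∀ {x : ι → ℕ → C0} {R : ℝ}, (∀ i k, ‖x i k‖ ≤ R) →
    (∀ i ∈ T, CoordConv (x i)) → (∀ i ∉ T, CoordNull (x i) ∨ ∃ c, ∀ k, x i k = c) →
    (∃ i ∉ T, CoordNull (x i)) → Tendsto (fun k => A fun i => x i k) atTop (𝓝 0) := by
  classical
  induction T using Finset.induction_on with
  | empty =>
    intro x R hR _ h2 h3
    refine tendsto_zero_of_coordNull A hR (Finset.univ.filter fun i => CoordNull (x i)) ?_ ?_ ?_
    · obtain ⟨i, -, hi⟩ := h3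
      exact ⟨i, by simpa using hi⟩
    · intro i hi; simpa using hi
    · intro i hi
      exact (h2 i (by simp)).resolve_left (by simpa using hi)
  | insert i T hiT ih =>
    intro x R hR h1 h2 ⟨i₀, hi₀, hn₀⟩
    have hi₀i : i₀ ≠ i := fun h => hi₀ (by simp [h])
    have hi₀T : i₀ ∉ T := fun h => hi₀ (by simp [h])
    refine tendsto_of_subseq_tendsto fun ns hns => ?_
    set y : ι → ℕ → C0 := fun i k => x i (ns k) with hy
    have hyT : ∀ i' ∈ T, CoordConv (y i') := fun i' hi' =>
      (h1 i' (Finset.mem_insert_of_mem hi')).comp hns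
    have hy2 : ∀ i' ≠ i, i' ∉ T → CoordNull (y i') ∨ ∃ c, ∀ k, y i' k = c := by
      intro i' hi' hT
      rcases h2 i' (by simp [hi', hT]) with h | ⟨c, hc⟩
      · exact Or.inl (h.comp hns)
      · exact Or.inr ⟨c, fun k => hc _⟩
    have hA1 : ∀ j, Tendsto (fun k => A (Function.update (fun i' => y i' k) i (y i j))) atTop
        (𝓝 0) := by
      intro j
      have h := ih (x := Function.update y i fun _ => y i j) (R := R) ?_ ?_ ?_ ⟨i₀, hi₀T, ?_⟩
      · refine h.congr fun k => ?_
        congr 1; ext1 i'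
        by_cases h : i' = i
        · subst h; simp
        · simp [h]
      · intro i' k
        by_cases h : i' = i
        · subst h; simpa using hR _ _
        · simpa [h] using hR _ _
      · intro i' hi'
        have h : i' ≠ i := fun h => hiT (h ▸ hi')
        simpa [h] using hyT i' hi'
      · intro i' hi'
        by_cases h : i' = i
        · subst h; simp
        · simpa [h] using hy2 i' h hi'
      · simpa [hi₀i] using hn₀.comp hns
    -- With slot `i` frozen at index `p`, the form tends to `0` by induction. The next index of the
    -- subsequence is taken so far out that freezing slot `i` at the previous index already gives a
    -- value below `1 / (j + 1)`.
    have hex : ∀ j p : ℕ, ∃ k > p,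
        ‖A (Function.update (fun i' => y i' k) i (y i p))‖ < 1 / ((j : ℝ) + 1) := by
      intro j p
      have h := (hA1 p).norm
      rw [norm_zero] at h
      exact ((eventually_gt_atTop p).and (h.eventually_lt_const (by positivity))).exists
    choose K hK1 hK2 using hex
    let φ : ℕ → ℕ := fun j => Nat.rec 0 (fun j p => K j p) j
    have hφs : ∀ j, φ (j + 1) = K j (φ j) := fun j => rfl
    have hφ : StrictMono φ := strictMono_nat_of_lt_succ fun j => by rw [hφs]; exact hK1 _ _
    have hφ1 : Tendsto (fun j => φ (j + 1)) atTop atTop :=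
      hφ.tendsto_atTop.comp (tendsto_add_atTop_nat 1)
    have hB1 : Tendsto (fun j => A (Function.update (fun i' => y i' (φ (j + 1))) i (y i (φ j))))
        atTop (𝓝 0) :=
      squeeze_zero_norm (fun j => by rw [hφs]; exact (hK2 j (φ j)).le)
        (tendsto_one_div_add_atTop_nhds_zero_nat (𝕜 := ℝ))
    have hB2 : Tendsto (fun j => A (Function.update (fun i' => y i' (φ (j + 1))) i
        (y i (φ (j + 1)) - y i (φ j)))) atTop (𝓝 0) := by
      have h := ih (x := Function.update (fun i' j => y i' (φ (j + 1))) i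
        fun j => y i (φ (j + 1)) - y i (φ j)) (R := R + R) ?_ ?_ ?_ ⟨i₀, hi₀T, ?_⟩
      · refine h.congr fun k => ?_
        congr 1; ext1 i'
        by_cases h : i' = i
        · subst h; simp
        · simp [h]
      · intro i' k
        by_cases h : i' = i
        · subst h
          simpa using (norm_sub_le _ _).trans (add_le_add (hR _ _) (hR _ _))
        · have hR0 : 0 ≤ R := (norm_nonneg _).trans (hR i' 0)
          simpa [h] using (hR i' _).trans (le_add_of_nonneg_left hR0)
      · intro i' hi'
        have h : i' ≠ i := fun h => hiT (h ▸ hi')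
        simpa [h] using (hyT i' hi').comp hφ1
      · intro i' hi'
        by_cases h : i' = i
        · subst h
          left
          obtain ⟨z, hz⟩ := (h1 i' (by simp)).comp hns
          intro m
          simpa using ((hz m).comp hφ1).sub ((hz m).comp hφ.tendsto_atTop)
        · rcases hy2 i' h hi' with h' | ⟨c, hc⟩
          · left; simpa [h] using h'.comp hφ1
          · right; exact ⟨c, fun k => by simpa [h] using hc _⟩
      · simpa [hi₀i] using (hn₀.comp hns).comp hφ1
    refine ⟨fun j => φ (j + 1), ?_⟩
    have := hB2.add hB1
    rw [add_zero] at this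
    refine this.congr fun j => ?_
    rw [A.map_update_sub, sub_add_cancel]
    congr 1
    exact Function.update_eq_self i _

end NullSequences

/-! ### Approximation of multilinear forms by finitely many coordinates. -/

section Truncation

/-- The projection of `c₀` onto the first `N` coordinates. -/
def trunc (N : ℕ) : C0 →L[ℂ] C0 :=
  ∑ k ∈ Finset.range N, (coordCLM k).smulRight (unitVec k)

theorem trunc_eq_sum (N : ℕ) (x : C0) :
    trunc N x = ∑ k ∈ Finset.range N, x k • unitVec k := by
  simp [trunc]

theorem sum_smul_unitVec_apply (a : ℕ → ℂ) (N m : ℕ) :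
    (∑ k ∈ Finset.range N, a k • unitVec k : C0) m = if m < N then a m else 0 := by
  rw [← coordCLM_apply, map_sum]
  simp [unitVec_apply]

theorem trunc_apply (N : ℕ) (x : C0) (m : ℕ) : trunc N x m = if m < N then x m else 0 := by
  rw [trunc_eq_sum, sum_smul_unitVec_apply]

theorem norm_trunc_le (N : ℕ) (x : C0) : ‖trunc N x‖ ≤ ‖x‖ := by
  refine norm_le_of_forall_coord (norm_nonneg _) fun m => ?_
  rw [trunc_apply]
  split_ifs
  · exact norm_coord_le x m
  · simp

theorem exists_norm_le_one_lt_norm {ι : Type*} [Fintype ι] {E : Type*} [NormedAddCommGroup E]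
    [NormedSpace ℂ E] (B : ContinuousMultilinearMap ℂ (fun _ : ι => E) ℂ) {ε : ℝ} (hε : 0 ≤ ε)
    (h : ε < ‖B‖) : ∃ x : ι → E, (∀ i, ‖x i‖ ≤ 1) ∧ ε < ‖B x‖ := by
  by_contra hcon
  push Not at hcon
  refine absurd (B.opNorm_le_bound hε fun m => ?_) (not_le.2 h)
  by_cases h0 : ∃ i, m i = 0
  · obtain ⟨i, hi⟩ := h0
    rw [B.map_coord_zero i hi, norm_zero]
    positivity
  · push Not at h0
    have hpos : 0 < ∏ i, ‖m i‖ := Finset.prod_pos fun i _ => norm_pos_iff.2 (h0 i)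
    have := hcon (fun i => ((‖m i‖ : ℂ)⁻¹) • m i) fun i => by
      rw [norm_smul, norm_inv, Complex.norm_real, norm_norm, inv_mul_cancel₀ (norm_ne_zero_iff.2 (h0 i))]
    rw [B.map_smul_univ, norm_smul, norm_prod] at this
    simp only [norm_inv, Complex.norm_real, norm_norm] at this
    rwa [Finset.prod_inv_distrib, inv_mul_le_iff₀ hpos, mul_comm] at this

/-- Otherwise there are unit-ball vectors `x k` on which the error exceeds `ε / 2`. By Tychonoff a
subsequence converges coordinatewise. Writing each vector as truncation `u` plus tail `d` and
expanding, every term but `A u` contains a coordinatewise null tail and tends to `0`. -/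
theorem tendsto_compContinuousLinearMap_trunc {ι : Type*} [Fintype ι] [DecidableEq ι]
    (A : ContinuousMultilinearMap ℂ (fun _ : ι => C0) ℂ) :
    Tendsto (fun N => A.compContinuousLinearMap fun _ => trunc N) atTop (𝓝 A) := by
  by_contra hcon
  replace hcon := mt (tendsto_iff_norm_sub_tendsto_zero
    (E := ContinuousMultilinearMap ℂ (fun _ : ι => C0) ℂ)).2 hcon
  rw [Metric.tendsto_atTop] at hcon
  push Not at hcon
  obtain ⟨ε, hε, hcon⟩ := hcon
  obtain ⟨ν, hν, hνε⟩ := extraction_of_frequently_atTop (Filter.frequently_atTop.2 hcon)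
  simp only [dist_zero_right, norm_norm] at hνε
  choose x hx1 hx2 using fun k => exists_norm_le_one_lt_norm _ (half_pos hε).le
    ((half_lt_self hε).trans_le (hνε k))
  have hcomp : IsCompact (Set.univ.pi fun _ : ι => Set.univ.pi fun _ : ℕ => closedBall (0 : ℂ) 1) :=
    isCompact_univ_pi fun _ => isCompact_univ_pi fun _ => isCompact_closedBall _ _
  obtain ⟨z, -, φ, hφ, hlim⟩ := hcomp.tendsto_subseq (x := fun k i m => x k i m) fun k => by
    simp only [Set.mem_pi, Set.mem_univ, forall_true_left, mem_closedBall_zero_iff]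
    exact fun i m => (norm_coord_le _ _).trans (hx1 k i)
  have hlim' : ∀ i m, Tendsto (fun k => x (φ k) i m) atTop (𝓝 (z i m)) := fun i m =>
    tendsto_pi_nhds.1 (tendsto_pi_nhds.1 hlim i) m
  have hνφ : Tendsto (fun k => ν (φ k)) atTop atTop := hν.tendsto_atTop.comp hφ.tendsto_atTop
  set u : ι → ℕ → C0 := fun i k => trunc (ν (φ k)) (x (φ k) i) with hu
  set d : ι → ℕ → C0 := fun i k => x (φ k) i - trunc (ν (φ k)) (x (φ k) i) with hd
  have hulim : ∀ i m, Tendsto (fun k => u i k m) atTop (𝓝 (z i m)) := by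
    intro i m
    refine (hlim' i m).congr' ?_
    filter_upwards [hνφ.eventually_gt_atTop m] with k hk
    simp [hu, trunc_apply, hk]
  have hdnull : ∀ i, CoordNull (d i) := by
    intro i m
    have := (hlim' i m).sub (hulim i m)
    rw [sub_self] at this
    exact this
  have hterm : ∀ s ∈ (Finset.univ : Finset (Finset ι)).erase Finset.univ,
      Tendsto (fun k => A (s.piecewise (fun i => u i k) fun i => d i k)) atTop (𝓝 0) := by
    intro s hs
    have hs' : ∃ i, i ∉ s := by
      by_contra h
      push Not at h
      exact (Finset.mem_erase.1 hs).1 (Finset.eq_univ_iff_forall.2 h)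
    have := tendsto_zero_of_coordConv A s (x := s.piecewise u d) (R := 2) ?_ ?_ ?_ ?_
    · refine this.congr fun k => ?_
      congr 1; ext1 i
      by_cases h : i ∈ s <;> simp [h]
    · intro i k
      have h1 := (norm_trunc_le (ν (φ k)) (x (φ k) i)).trans (hx1 _ i)
      by_cases h : i ∈ s
      · simp only [h, Finset.piecewise_eq_of_mem, hu]; linarith
      · simp only [h, not_false_eq_true, Finset.piecewise_eq_of_notMem, hd]
        linarith [norm_sub_le (x (φ k) i) (trunc (ν (φ k)) (x (φ k) i)), hx1 (φ k) i]
    · intro i hi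
      simp only [hi, Finset.piecewise_eq_of_mem]
      exact ⟨z i, hulim i⟩
    · intro i hi
      simp only [hi, not_false_eq_true, Finset.piecewise_eq_of_notMem]
      exact Or.inl (hdnull i)
    · obtain ⟨i, hi⟩ := hs'
      refine ⟨i, hi, ?_⟩
      simp only [hi, not_false_eq_true, Finset.piecewise_eq_of_notMem]
      exact hdnull i
  have hsum := tendsto_finsetSum _ hterm
  rw [Finset.sum_const_zero] at hsum
  have heq : ∀ k, ∑ s ∈ (Finset.univ : Finset (Finset ι)).erase Finset.univ,
      A (s.piecewise (fun i => u i k) fun i => d i k) =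
      -((A.compContinuousLinearMap (fun _ => trunc (ν (φ k))) - A) (x (φ k))) := by
    intro k
    have h1 : x (φ k) = (fun i => u i k) + fun i => d i k := by
      ext1 i; simp [hu, hd]
    have h2 := A.map_add_univ (fun i => u i k) fun i => d i k
    rw [← h1, ← Finset.add_sum_erase _ _ (Finset.mem_univ Finset.univ), Finset.piecewise_univ] at h2
    simp only [sub_apply,
      ContinuousMultilinearMap.compContinuousLinearMap_apply, neg_sub]
    rw [h2]
    simp [hu]
  simp only [heq] at hsum
  have h3 := hsum.norm
  rw [norm_zero] at h3
  obtain ⟨k, hk⟩ := (h3.eventually_lt_const (half_pos hε)).exists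
  rw [norm_neg] at hk
  exact absurd (hx2 (φ k)) (not_lt.2 hk.le)

end Truncation


/-! ### The Aron–Berner extension on `c₀` as a limit along truncations. -/

section AronBernerC0

/-- The bidual of a complex normed space. -/
abbrev Bidual (E : Type*) [NormedAddCommGroup E] [NormedSpace ℂ E] : Type _ :=
  StrongDual ℂ (StrongDual ℂ E)

/-- The `N`-th truncation, as an element of `c₀`, of an element of the bidual of `c₀`. -/
def bidualTrunc (z : Bidual C0) (N : ℕ) : C0 :=
  ∑ k ∈ Finset.range N, z (coordCLM k) • unitVec k

theorem bidualTrunc_apply (z : Bidual C0) (N m : ℕ) :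
    bidualTrunc z N m = if m < N then z (coordCLM m) else 0 :=
  sum_smul_unitVec_apply (fun k => z (coordCLM k)) N m

theorem bidualTrunc_sub (z w : Bidual C0) (N : ℕ) :
    bidualTrunc (z - w) N = bidualTrunc z N - bidualTrunc w N := by
  ext m
  rw [ZeroAtInftyContinuousMap.sub_apply, bidualTrunc_apply, bidualTrunc_apply, bidualTrunc_apply]
  split_ifs <;> simp

theorem norm_bidualTrunc_le (z : Bidual C0) (N : ℕ) :
    ‖bidualTrunc z N‖ ≤ ‖z‖ := by
  refine norm_le_of_forall_coord (ContinuousLinearMap.opNorm_nonneg z) fun m => ?_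
  rw [bidualTrunc_apply]
  split_ifs
  · exact (z.le_opNorm _).trans (mul_le_of_le_one_right (norm_nonneg _) (norm_coordCLM_le m))
  · rw [norm_zero]
    exact ContinuousLinearMap.opNorm_nonneg z

theorem aronBernerForm_succ (z : Bidual C0) (n : ℕ)
    (A : ContinuousMultilinearMap ℂ (fun _ : Fin (n + 1) => C0) ℂ) :
    aronBernerForm z (n + 1) A = z ((aronBernerForm z n) ∘L A.curryLeft) := rfl

/-- A form of finitely many coordinates sees `z` only through its values on the coordinate
functionals, where `z` acts like a vector of `c₀`. -/
theorem aronBernerForm_comp_trunc (z : Bidual C0) (N n : ℕ)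
    (A : ContinuousMultilinearMap ℂ (fun _ : Fin n => C0) ℂ) :
    aronBernerForm z n (A.compContinuousLinearMap fun _ => trunc N) =
      A fun _ => bidualTrunc z N := by
  induction n with
  | zero =>
    change A _ = A _
    congr 1
    exact Subsingleton.elim _ _
  | succ n ih =>
    rw [aronBernerForm_succ]
    have h : (aronBernerForm z n) ∘L
        (A.compContinuousLinearMap fun _ => trunc N).curryLeft =
        ∑ k ∈ Finset.range N, (A.curryLeft (unitVec k) fun _ => bidualTrunc z N) • coordCLM k := by
      ext x
      have h1 : (A.compContinuousLinearMap fun _ => trunc N).curryLeft x =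
          (A.curryLeft (trunc N x)).compContinuousLinearMap fun _ => trunc N := by
        ext m
        simp only [ContinuousMultilinearMap.curryLeft_apply,
          ContinuousMultilinearMap.compContinuousLinearMap_apply]
        congr 1; ext1 i
        refine Fin.cases ?_ (fun i => ?_) i <;> simp
      rw [ContinuousLinearMap.comp_apply, h1, ih, trunc_eq_sum, map_sum]
      simp [mul_comm]
    rw [h, map_sum]
    simp only [map_smul, smul_eq_mul]
    have h2 : (fun _ : Fin (n + 1) => bidualTrunc z N) =
        Fin.cons (bidualTrunc z N) fun _ => bidualTrunc z N := by
      ext1 i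
      refine Fin.cases ?_ (fun i => ?_) i <;> simp
    rw [h2, ← ContinuousMultilinearMap.curryLeft_apply]
    conv_rhs => rw [show A.curryLeft (bidualTrunc z N) =
      ∑ k ∈ Finset.range N, z (coordCLM k) • A.curryLeft (unitVec k) by
        conv_lhs => rw [bidualTrunc, map_sum]
        simp only [map_smul]]
    simp [mul_comm]

theorem tendsto_apply_bidualTrunc (z : Bidual C0) {n : ℕ}
    (A : ContinuousMultilinearMap ℂ (fun _ : Fin n => C0) ℂ) :
    Tendsto (fun N => A fun _ => bidualTrunc z N) atTop (𝓝 (aronBernerForm z n A)) := by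
  have := ((aronBernerForm z n).continuous.tendsto A).comp (tendsto_compContinuousLinearMap_trunc A)
  exact this.congr fun N => aronBernerForm_comp_trunc z N n A

theorem differentiableOn_extend {E : Type*} [NormedAddCommGroup E] [NormedSpace ℂ E]
    (f : HInfty E) :
    DifferentiableOn ℂ (Function.extend Subtype.val (f.1 : ball (0 : E) 1 → ℂ) 0) (ball 0 1) :=
  f.2

theorem norm_extend_le {E : Type*} [NormedAddCommGroup E] (f : ball (0 : E) 1 →ᵇ ℂ) :
    ∀ x ∈ ball (0 : E) 1, ‖Function.extend Subtype.val (f : ball (0 : E) 1 → ℂ) 0 x‖ ≤ ‖f‖ := by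
  intro x hx
  rw [extend_apply_ball _ hx]
  exact f.norm_coe_le_norm _

theorem bidualTrunc_mem_ball {z : Bidual C0} (hz : ‖z‖ < 1) (N : ℕ) :
    bidualTrunc z N ∈ ball (0 : C0) 1 := by
  rw [mem_ball_zero_iff]
  exact (norm_bidualTrunc_le z N).trans_lt hz

/-- Dominated convergence in the Taylor series: the `n`-th terms at all truncations are bounded by
`‖f‖ * ρ ^ n` for one `ρ` with `‖z‖ < ρ < 1`. -/
theorem tendsto_apply_aronBernerSeries (f : HInfty C0) {z : Bidual C0}
    (hz : ‖z‖ < 1) :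
    Tendsto (fun N => f.1 ⟨bidualTrunc z N, bidualTrunc_mem_ball hz N⟩) atTop
      (𝓝 (aronBernerSeries f.1 z)) := by
  obtain ⟨ρ, hzρ, hρ⟩ := exists_between hz
  have hρ0 : 0 ≤ ρ := (norm_nonneg z).trans hzρ.le
  have key := tendsto_tsum_of_dominated_convergence (𝓕 := atTop) (bound := fun n => ‖f.1‖ * ρ ^ n)
    (f := fun N n => (n.factorial : ℂ)⁻¹ * iteratedFDeriv ℂ n
      (Function.extend Subtype.val (f.1 : ball (0 : C0) 1 → ℂ) 0) 0 fun _ => bidualTrunc z N)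
    (g := fun n => (n.factorial : ℂ)⁻¹ * aronBernerForm z n (iteratedFDeriv ℂ n
      (Function.extend Subtype.val (f.1 : ball (0 : C0) 1 → ℂ) 0) 0))
    ((summable_geometric_of_lt_one hρ0 hρ).mul_left _)
    (fun n => (tendsto_apply_bidualTrunc z _).const_mul _)
    (.of_forall fun N n => norm_iteratedFDeriv_apply_diag_le (differentiableOn_extend f)
      (norm_extend_le f.1) ((norm_bidualTrunc_le z N).trans_lt hzρ) n)
  refine key.congr fun N => ?_
  have hN := bidualTrunc_mem_ball hz N
  rw [(hasSum_iteratedFDeriv_apply_diag (differentiableOn_extend f)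
    (mem_ball_zero_iff.1 hN)).tsum_eq, extend_apply_ball _ hN]

end AronBernerC0

/-! ### Density of polynomials in the coordinates. -/

section Density

/-- Evaluation at a point of the unit ball on `AUnif`. -/
def evalAUnif {E : Type*} [NormedAddCommGroup E] [NormedSpace ℂ E] (x : ball (0 : E) 1) :
    AUnif E →ₐ[ℂ] ℂ where
  toFun f := f.1 x
  map_one' := rfl
  map_mul' _ _ := rfl
  map_zero' := rfl
  map_add' _ _ := rfl
  commutes' _ := rfl

theorem evalAUnif_apply {E : Type*} [NormedAddCommGroup E] [NormedSpace ℂ E] (x : ball (0 : E) 1)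
    (f : AUnif E) : evalAUnif x f = f.1 x := rfl

/-- The `n`-th coordinate function as an element of `AUnif C0`. -/
def coordA (n : ℕ) : AUnif C0 :=
  ⟨BoundedContinuousFunction.ofNormedAddCommGroup (fun x : ball (0 : C0) 1 => coordCLM n x)
    ((coordCLM n).continuous.comp continuous_subtype_val) 1 fun x =>
      (norm_coord_le x.1 n).trans (mem_ball_zero_iff.1 x.2).le,
    (isHolomorphic_iff _).2 ⟨coordCLM n, (coordCLM n).differentiable.differentiableOn, fun _ => rfl⟩,
    (coordCLM n).uniformContinuous.comp uniformContinuous_subtype_val⟩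

theorem exists_mem_adjoin_coordA {n : ℕ} (N : ℕ)
    (B : ContinuousMultilinearMap ℂ (fun _ : Fin n => C0) ℂ) :
    ∃ q ∈ Algebra.adjoin ℂ (Set.range coordA), ∀ x, q.1 x = B fun _ => trunc N x.1 := by
  refine ⟨∑ r ∈ Fintype.piFinset fun _ : Fin n => Finset.range N,
    B (fun i => unitVec (r i)) • ∏ i, coordA (r i), ?_, fun x => ?_⟩
  · exact Subalgebra.sum_mem _ fun r _ => Subalgebra.smul_mem _
      (Subalgebra.prod_mem _ fun i _ => Algebra.subset_adjoin (Set.mem_range_self _)) _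
  · rw [← evalAUnif_apply, map_sum]
    simp only [trunc_eq_sum]
    have := B.toMultilinearMap.map_sum_finset (fun _ k => x.1 k • unitVec k)
      fun _ => Finset.range N
    refine Eq.trans (Finset.sum_congr rfl fun r _ => ?_) this.symm
    refine Eq.trans ?_ (B.map_smul_univ (fun i => x.1 (r i)) fun i => unitVec (r i)).symm
    rw [map_smul, map_prod, smul_eq_mul, smul_eq_mul, mul_comm]
    rfl

/-- Three errors of `ε / 3`: dilating to `f (r x)` by uniform continuity, cutting the Taylor series
at degree `m` (geometric decay in `r`), and truncating the finitely many forms to `N` coordinates.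
-/
theorem exists_mem_adjoin_coordA_norm_sub_le (f : AUnif C0) {ε : ℝ} (hε : 0 < ε) :
    ∃ q ∈ Algebra.adjoin ℂ (Set.range coordA), ‖f - q‖ ≤ ε := by
  obtain ⟨δ, hδ, hfδ⟩ := Metric.uniformContinuous_iff.1 f.2.2 (ε / 3) (by positivity)
  obtain ⟨r, hr0, hr1, hrδ⟩ : ∃ r : ℝ, 0 < r ∧ r < 1 ∧ 1 - r < δ := by
    refine ⟨1 - min δ 1 / 2, ?_, ?_, ?_⟩
    · linarith [min_le_right δ 1]
    · linarith [lt_min hδ one_pos]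
    · linarith [min_le_left δ 1, lt_min hδ one_pos]
  set f' : HInfty C0 := ⟨f.1, f.2.1⟩ with hf'
  set G : C0 → ℂ := Function.extend Subtype.val (f.1 : ball (0 : C0) 1 → ℂ) 0 with hG
  have hGd : DifferentiableOn ℂ G (ball 0 1) := differentiableOn_extend f'
  obtain ⟨m, hm⟩ : ∃ m : ℕ, ‖f.1‖ * r ^ m / (1 - r) < ε / 3 := by
    have : Tendsto (fun m : ℕ => ‖f.1‖ * r ^ m / (1 - r)) atTop (𝓝 0) := by
      simpa using ((tendsto_pow_atTop_nhds_zero_of_lt_one hr0.le hr1).const_mul ‖f.1‖).div_const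
        (1 - r)
    exact (this.eventually_lt_const (by positivity)).exists
  set A : (n : ℕ) → ContinuousMultilinearMap ℂ (fun _ : Fin n => C0) ℂ := fun n =>
    (n.factorial : ℂ)⁻¹ • iteratedFDeriv ℂ n G 0 with hA
  obtain ⟨N, hN⟩ : ∃ N, ∑ n ∈ Finset.range m,
      ‖(A n).compContinuousLinearMap (fun _ => trunc N) - A n‖ < ε / 3 := by
    have h : Tendsto (fun N => ∑ n ∈ Finset.range m,
        ‖(A n).compContinuousLinearMap (fun _ => trunc N) - A n‖) atTop (𝓝 0) := by
      have := tendsto_finsetSum (Finset.range m) fun n _ =>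
        (tendsto_iff_norm_sub_tendsto_zero
          (E := ContinuousMultilinearMap ℂ (fun _ : Fin n => C0) ℂ)).1
          (tendsto_compContinuousLinearMap_trunc (A n))
      simpa using this
    exact (h.eventually_lt_const (by positivity)).exists
  choose q hq hqx using fun n => exists_mem_adjoin_coordA N
    ((A n).compContinuousLinearMap fun _ => (r : ℂ) • ContinuousLinearMap.id ℂ C0)
  refine ⟨∑ n ∈ Finset.range m, q n, Subalgebra.sum_mem _ fun n _ => hq n, ?_⟩
  refine (BoundedContinuousFunction.norm_le hε.le).2 fun x => ?_
  have hx := mem_ball_zero_iff.1 x.2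
  have hnr : ‖(r : ℂ) • x.1‖ < r := by
    rw [norm_smul, Complex.norm_real, Real.norm_of_nonneg hr0.le]
    exact mul_lt_of_lt_one_right hr0 hx
  have hrx : (r : ℂ) • x.1 ∈ ball (0 : C0) 1 := mem_ball_zero_iff.2 (hnr.trans hr1)
  have hval : (f - ∑ n ∈ Finset.range m, q n : AUnif C0).1 x =
      f.1 x - ∑ n ∈ Finset.range m, A n fun _ => trunc N ((r : ℂ) • x.1) := by
    rw [← evalAUnif_apply, map_sub, map_sum]
    simp only [evalAUnif_apply, hqx]
    simp
  change ‖(f - ∑ n ∈ Finset.range m, q n : AUnif C0).1 x‖ ≤ ε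
  rw [hval]
  have h1 : ‖f.1 x - f.1 ⟨(r : ℂ) • x.1, hrx⟩‖ ≤ ε / 3 := by
    rw [← dist_eq_norm]
    refine (hfδ ?_).le
    rw [Subtype.dist_eq, dist_eq_norm]
    have : x.1 - (r : ℂ) • x.1 = ((1 - r : ℝ) : ℂ) • x.1 := by
      ext m
      simp only [ZeroAtInftyContinuousMap.sub_apply, ZeroAtInftyContinuousMap.smul_apply,
        smul_eq_mul]
      push_cast
      ring
    change ‖x.1 - (r : ℂ) • x.1‖ < δ
    rw [this, norm_smul, Complex.norm_real, Real.norm_of_nonneg (by linarith)]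
    exact (mul_le_of_le_one_right (by linarith) hx.le).trans_lt hrδ
  have h2 : ‖∑ n ∈ Finset.range m, A n (fun _ => (r : ℂ) • x.1) - f.1 ⟨(r : ℂ) • x.1, hrx⟩‖ ≤
      ε / 3 := by
    rw [← extend_apply_ball (f.1 : ball (0 : C0) 1 → ℂ) hrx]
    refine (norm_sub_le_of_geometric_bound_of_hasSum hr1 (C := ‖f.1‖) (fun n => ?_)
      (hasSum_iteratedFDeriv_apply_diag hGd (mem_ball_zero_iff.1 hrx)) m).trans hm.le
    exact norm_iteratedFDeriv_apply_diag_le hGd (norm_extend_le f.1) hnr n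
  have h3 : ‖∑ n ∈ Finset.range m, A n (fun _ => trunc N ((r : ℂ) • x.1)) -
      ∑ n ∈ Finset.range m, A n (fun _ => (r : ℂ) • x.1)‖ ≤ ε / 3 := by
    rw [← Finset.sum_sub_distrib]
    refine (norm_sum_le_of_le _ fun n _ => ?_).trans hN.le
    have := ((A n).compContinuousLinearMap (fun _ => trunc N) - A n).le_opNorm_mul_pow_card_of_le
      (m := fun _ => (r : ℂ) • x.1) (b := 1)
      ((pi_norm_le_iff_of_nonneg zero_le_one).2 fun _ => (hnr.trans hr1).le)
    simpa using this
  calc _ = ‖(f.1 x - f.1 ⟨(r : ℂ) • x.1, hrx⟩) -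
        (∑ n ∈ Finset.range m, A n (fun _ => (r : ℂ) • x.1) - f.1 ⟨(r : ℂ) • x.1, hrx⟩) -
        (∑ n ∈ Finset.range m, A n (fun _ => trunc N ((r : ℂ) • x.1)) -
          ∑ n ∈ Finset.range m, A n (fun _ => (r : ℂ) • x.1))‖ := by congr 1; ring
    _ ≤ ε / 3 + ε / 3 + ε / 3 :=
      (norm_sub_le _ _).trans (add_le_add ((norm_sub_le _ _).trans (add_le_add h1 h2)) h3)
    _ = ε := by ring

theorem mem_of_isClosed_of_coordA_mem (S : Subalgebra ℂ (AUnif C0))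
    (hS : IsClosed (S : Set (AUnif C0))) (h : ∀ n, coordA n ∈ S) (f : AUnif C0) : f ∈ S := by
  have hle : Algebra.adjoin ℂ (Set.range coordA) ≤ S := Algebra.adjoin_le (by
    rintro _ ⟨n, rfl⟩; exact h n)
  rw [← SetLike.mem_coe, ← hS.closure_eq, Metric.mem_closure_iff]
  intro ε hε
  obtain ⟨q, hq, hfq⟩ := exists_mem_adjoin_coordA_norm_sub_le f (half_pos hε)
  exact ⟨q, hle hq, by rw [dist_eq_norm]; linarith⟩

end Density


/-! ### The canonical extension as a character at each point of the closed bidual ball. -/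

section CanonicalExtension

theorem Bidual.norm_lt_one {E : Type*} [NormedAddCommGroup E] [NormedSpace ℂ E] {z : Bidual E}
    (hz : z ∈ ball (0 : Bidual E) 1) : ‖z‖ < 1 :=
  (mem_ball_zero_iff (E := Bidual E)).1 hz

theorem Bidual.norm_sub_lt {E : Type*} [NormedAddCommGroup E] [NormedSpace ℂ E] {z w : Bidual E}
    {δ : ℝ} (h : dist z w < δ) : ‖z - w‖ < δ := by
  rwa [dist_eq_norm (E := Bidual E)] at h

theorem Bidual.mem_closure_ball {E : Type*} [NormedAddCommGroup E] [NormedSpace ℂ E]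
    {z : Bidual E} (hz : ‖z‖ ≤ 1) : z ∈ closure (ball (0 : Bidual E) 1) := by
  rw [closure_ball (0 : Bidual E) one_ne_zero]
  exact (mem_closedBall_zero_iff (E := Bidual E)).2 hz

theorem tendsto_aronBernerSeries (f : AUnif C0) {z : Bidual C0} (hz : ‖z‖ < 1) :
    Tendsto (fun N => f.1 ⟨bidualTrunc z N, bidualTrunc_mem_ball hz N⟩) atTop
      (𝓝 (aronBernerSeries f.1 z)) :=
  tendsto_apply_aronBernerSeries ⟨f.1, f.2.1⟩ hz

theorem norm_aronBernerSeries_le (f : AUnif C0) {z : Bidual C0} (hz : ‖z‖ < 1) :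
    ‖aronBernerSeries f.1 z‖ ≤ ‖f‖ :=
  le_of_tendsto (tendsto_aronBernerSeries f hz).norm
    (.of_forall fun _ => f.1.norm_coe_le_norm _)

theorem aronBernerSeries_add (f g : AUnif C0) {z : Bidual C0} (hz : ‖z‖ < 1) :
    aronBernerSeries (f + g : AUnif C0).1 z = aronBernerSeries f.1 z + aronBernerSeries g.1 z :=
  tendsto_nhds_unique (tendsto_aronBernerSeries (f + g) hz)
    ((tendsto_aronBernerSeries f hz).add (tendsto_aronBernerSeries g hz))

theorem aronBernerSeries_mul (f g : AUnif C0) {z : Bidual C0} (hz : ‖z‖ < 1) :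
    aronBernerSeries (f * g : AUnif C0).1 z = aronBernerSeries f.1 z * aronBernerSeries g.1 z :=
  tendsto_nhds_unique (tendsto_aronBernerSeries (f * g) hz)
    ((tendsto_aronBernerSeries f hz).mul (tendsto_aronBernerSeries g hz))

theorem aronBernerSeries_algebraMap (c : ℂ) {z : Bidual C0} (hz : ‖z‖ < 1) :
    aronBernerSeries (algebraMap ℂ (AUnif C0) c).1 z = c :=
  tendsto_nhds_unique (tendsto_aronBernerSeries (algebraMap ℂ (AUnif C0) c) hz)
    tendsto_const_nhds

/-- Truncation is linear and contractive, so the modulus of continuity of `f` passes to the limit.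
-/
theorem dist_aronBernerSeries_le (f : AUnif C0) {ε : ℝ} (hε : 0 < ε) :
    ∃ δ > 0, ∀ z w : Bidual C0, ‖z‖ < 1 → ‖w‖ < 1 → dist z w < δ →
      dist (aronBernerSeries f.1 z) (aronBernerSeries f.1 w) ≤ ε := by
  obtain ⟨δ, hδ, h⟩ := Metric.uniformContinuous_iff.1 f.2.2 ε hε
  refine ⟨δ, hδ, fun z w hz hw hzw => ?_⟩
  refine le_of_tendsto ((tendsto_aronBernerSeries f hz).dist (tendsto_aronBernerSeries f hw))
    (.of_forall fun N => (h ?_).le)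
  rw [Subtype.dist_eq, dist_eq_norm, ← bidualTrunc_sub]
  exact (norm_bidualTrunc_le _ N).trans_lt (Bidual.norm_sub_lt hzw)

/-- Uniform continuity of the series on the open ball provides the limit at the sphere, so
`extendFrom` does not take a junk value there. -/
theorem tendsto_canonicalExtension (f : AUnif C0) {z : Bidual C0} (hz : ‖z‖ ≤ 1) :
    Tendsto (aronBernerSeries (f.1 : ball (0 : C0) 1 → ℂ)) (𝓝[ball (0 : Bidual C0) 1] z)
      (𝓝 (canonicalExtension (f.1 : ball (0 : C0) 1 → ℂ) z)) := by
  have hcl := Bidual.mem_closure_ball hz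
  have : (𝓝[ball (0 : Bidual C0) 1] z).NeBot := mem_closure_iff_nhdsWithin_neBot.1 hcl
  have hex : ∃ y, Tendsto (aronBernerSeries (f.1 : ball (0 : C0) 1 → ℂ))
      (𝓝[ball (0 : Bidual C0) 1] z) (𝓝 y) := by
    refine cauchy_map_iff_exists_tendsto.1 (Metric.cauchy_iff.2 ⟨inferInstance, fun ε hε => ?_⟩)
    obtain ⟨δ, hδ, h⟩ := dist_aronBernerSeries_le f (half_pos hε)
    refine ⟨_, image_mem_map (inter_mem self_mem_nhdsWithin
      (mem_nhdsWithin_of_mem_nhds (ball_mem_nhds z (half_pos hδ)))), ?_⟩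
    rintro _ ⟨a, ⟨ha, haz⟩, rfl⟩ _ ⟨b, ⟨hb, hbz⟩, rfl⟩
    refine (h a b (Bidual.norm_lt_one ha) (Bidual.norm_lt_one hb) ?_).trans_lt (half_lt_self hε)
    have := dist_triangle_right a b z
    rw [mem_ball] at haz hbz
    linarith
  obtain ⟨y, hy⟩ := hex
  have h2 := extendFrom_eq hcl hy
  rw [canonicalExtension, h2]
  exact hy

/-- Evaluation of the canonical extension at a point of the closed unit ball of the bidual. -/
def bidualEval (z : Bidual C0) (hz : ‖z‖ ≤ 1) : AUnif C0 →ₐ[ℂ] ℂ :=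
  have : (𝓝[ball (0 : Bidual C0) 1] z).NeBot :=
    mem_closure_iff_nhdsWithin_neBot.1 (Bidual.mem_closure_ball hz)
  AlgHom.ofLinearMap
    { toFun := fun f => canonicalExtension (f.1 : ball (0 : C0) 1 → ℂ) z
      map_add' := fun f g => tendsto_nhds_unique ((tendsto_canonicalExtension (f + g) hz).congr'
        (by
          filter_upwards [self_mem_nhdsWithin] with y hy
          exact aronBernerSeries_add f g (Bidual.norm_lt_one hy)))
        ((tendsto_canonicalExtension f hz).add (tendsto_canonicalExtension g hz))
      map_smul' := fun c f => by
        refine tendsto_nhds_unique ((tendsto_canonicalExtension (c • f) hz).congr' ?_)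
          ((tendsto_canonicalExtension f hz).const_mul c)
        filter_upwards [self_mem_nhdsWithin] with y hy
        rw [Algebra.smul_def, aronBernerSeries_mul _ _ (Bidual.norm_lt_one hy),
          aronBernerSeries_algebraMap _ (Bidual.norm_lt_one hy)] }
    (by
      refine tendsto_nhds_unique ((tendsto_canonicalExtension 1 hz).congr' ?_)
        tendsto_const_nhds
      filter_upwards [self_mem_nhdsWithin] with y hy
      rw [← map_one (algebraMap ℂ (AUnif C0)),
        aronBernerSeries_algebraMap _ (Bidual.norm_lt_one hy)])
    fun f g => by
      refine tendsto_nhds_unique ((tendsto_canonicalExtension (f * g) hz).congr' ?_)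
        ((tendsto_canonicalExtension f hz).mul (tendsto_canonicalExtension g hz))
      filter_upwards [self_mem_nhdsWithin] with y hy
      exact aronBernerSeries_mul f g (Bidual.norm_lt_one hy)

theorem norm_bidualEval_le (z : Bidual C0) (hz : ‖z‖ ≤ 1) (f : AUnif C0) :
    ‖bidualEval z hz f‖ ≤ ‖f‖ := by
  have : (𝓝[ball (0 : Bidual C0) 1] z).NeBot :=
    mem_closure_iff_nhdsWithin_neBot.1 (Bidual.mem_closure_ball hz)
  refine le_of_tendsto (tendsto_canonicalExtension f hz).norm ?_
  filter_upwards [self_mem_nhdsWithin] with y hy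
  exact norm_aronBernerSeries_le f (Bidual.norm_lt_one hy)

end CanonicalExtension

/-! ### The disk algebra inside the algebra on the ball of `c₀`. -/

section DiskAlgebra

theorem coord_mem_ball (n : ℕ) (x : ball (0 : C0) 1) : x.1 n ∈ ball (0 : ℂ) 1 :=
  mem_ball_zero_iff.2 ((norm_coord_le x.1 n).trans_lt (mem_ball_zero_iff.1 x.2))

/-- The embedding of the disk algebra into `AUnif C0` as functions of the `n`-th coordinate. -/
def diskInclusion (n : ℕ) : DiskAlgebra →ₐ[ℂ] AUnif C0 where
  toFun s :=
    ⟨(BoundedContinuousFunction.mkOfCompact s.1).compContinuous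
      ⟨fun x : ball (0 : C0) 1 => ⟨x.1 n, ball_subset_closedBall (coord_mem_ball n x)⟩,
        ((coordCLM n).continuous.comp continuous_subtype_val).subtype_mk _⟩, by
      obtain ⟨G, hG, h⟩ := (isHolomorphic_iff _).1 s.2
      exact (isHolomorphic_iff _).2 ⟨fun x => G (coordCLM n x),
        hG.comp (coordCLM n).differentiable.differentiableOn fun x hx => coord_mem_ball n ⟨x, hx⟩,
        fun x => h ⟨x.1 n, coord_mem_ball n x⟩⟩,
      (CompactSpace.uniformContinuous_of_continuous s.1.continuous).comp
        (((coordCLM n).uniformContinuous.comp uniformContinuous_subtype_val).subtype_mk _)⟩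
  map_one' := rfl
  map_mul' _ _ := rfl
  map_zero' := rfl
  map_add' _ _ := rfl
  commutes' _ := rfl

theorem diskInclusion_apply (n : ℕ) (s : DiskAlgebra) (x : ball (0 : C0) 1) :
    (diskInclusion n s).1 x = s.1 ⟨x.1 n, ball_subset_closedBall (coord_mem_ball n x)⟩ := rfl

theorem norm_diskInclusion_le (n : ℕ) (s : DiskAlgebra) : ‖diskInclusion n s‖ ≤ ‖s‖ :=
  (BoundedContinuousFunction.norm_le (norm_nonneg _)).2 fun _ => s.1.norm_coe_le_norm _

/-- The identity function in the disk algebra. -/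
def diskId : DiskAlgebra :=
  ⟨⟨Subtype.val, continuous_subtype_val⟩,
    (isHolomorphic_iff _).2 ⟨id, differentiableOn_id, fun _ => rfl⟩⟩

theorem diskId_apply (z : closedBall (0 : ℂ) 1) : diskId.1 z = z := rfl

theorem diskInclusion_diskId (n : ℕ) : diskInclusion n diskId = coordA n := rfl

end DiskAlgebra

/-! ### Evaluation at points of the closed ball of `ℓ_∞`, and slices. -/

section PointEvaluation

/-- A sequence in the closed unit disk as an element of `ℓ_∞`. -/
def toLInfty (w : ℕ → closedBall (0 : ℂ) 1) : LInfty :=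
  ⟨fun n => w n, memℓp_infty ⟨1, by
    rintro _ ⟨n, rfl⟩
    exact mem_closedBall_zero_iff.1 (w n).2⟩⟩

/-- A sequence in the closed unit disk as an element of the bidual of `c₀`. -/
def toBidualC0 (w : ℕ → closedBall (0 : ℂ) 1) : Bidual C0 := toBidual (toLInfty w)

theorem norm_toBidualC0_le (w : ℕ → closedBall (0 : ℂ) 1) : ‖toBidualC0 w‖ ≤ 1 := by
  have h : ‖toLInfty w‖ ≤ 1 :=
    lp.norm_le_of_forall_le zero_le_one fun n => mem_closedBall_zero_iff.1 (w n).2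
  unfold toBidualC0 toBidual
  exact (LinearMap.mkContinuous_norm_le _ (norm_nonneg (toLInfty w)) _).trans h

theorem toBidualC0_coordCLM (w : ℕ → closedBall (0 : ℂ) 1) (n : ℕ) :
    toBidualC0 w (coordCLM n) = w n := by
  change ∑' k, (w k : ℂ) * unitVec k n = w n
  rw [tsum_eq_single n fun k hk => by simp [unitVec_apply, hk.symm]]
  simp [unitVec_apply]

/-- Evaluation of the canonical extension at a point of the closed unit ball of `ℓ_∞`. -/
def pointEval (w : ℕ → closedBall (0 : ℂ) 1) : AUnif C0 →ₐ[ℂ] ℂ :=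
  bidualEval (toBidualC0 w) (norm_toBidualC0_le w)

theorem norm_pointEval_le (w : ℕ → closedBall (0 : ℂ) 1) (f : AUnif C0) :
    ‖pointEval w f‖ ≤ ‖f‖ :=
  norm_bidualEval_le _ _ f

theorem aronBernerSeries_diskInclusion (n : ℕ) (s : DiskAlgebra) {z : Bidual C0} (hz : ‖z‖ < 1) :
    aronBernerSeries (diskInclusion n s).1 z =
      Function.extend Subtype.val (s.1 : closedBall (0 : ℂ) 1 → ℂ) 0 (z (coordCLM n)) := by
  refine tendsto_nhds_unique (tendsto_aronBernerSeries (diskInclusion n s) hz)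
    (tendsto_const_nhds.congr' ?_)
  filter_upwards [eventually_gt_atTop n] with N hN
  rw [diskInclusion_apply, ← Subtype.val_injective.extend_apply s.1 0]
  simp [bidualTrunc_apply, hN]

/-- On the open ball this is `aronBernerSeries_diskInclusion`; continuity of `s` on the closed disk
carries it to the sphere, as needed when `‖w n‖ = 1`. -/
theorem pointEval_diskInclusion (w : ℕ → closedBall (0 : ℂ) 1) (n : ℕ) (s : DiskAlgebra) :
    pointEval w (diskInclusion n s) = s.1 (w n) := by
  have hz := norm_toBidualC0_le w
  have : (𝓝[ball (0 : Bidual C0) 1] (toBidualC0 w)).NeBot :=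
    mem_closure_iff_nhdsWithin_neBot.1 (Bidual.mem_closure_ball hz)
  set G : ℂ → ℂ := Function.extend Subtype.val (s.1 : closedBall (0 : ℂ) 1 → ℂ) 0 with hG
  have hGs : ∀ z : closedBall (0 : ℂ) 1, G z = s.1 z := fun z =>
    Subtype.val_injective.extend_apply s.1 0 z
  have hGc : ContinuousOn G (closedBall 0 1) := by
    rw [continuousOn_iff_continuous_domRestrict]
    exact s.1.continuous.congr fun z => (hGs z).symm
  have hlim : Tendsto (fun y : Bidual C0 => y (coordCLM n)) (𝓝[ball (0 : Bidual C0) 1] (toBidualC0 w))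
      (𝓝[closedBall 0 1] (w n : ℂ)) := by
    refine tendsto_nhdsWithin_iff.2 ⟨?_, ?_⟩
    · rw [← toBidualC0_coordCLM w n]
      have hc : Continuous fun y : Bidual C0 => y (coordCLM n) := by fun_prop
      exact (hc.tendsto _).mono_left nhdsWithin_le_nhds
    · filter_upwards [self_mem_nhdsWithin] with y hy
      rw [mem_closedBall_zero_iff]
      have h1 : ‖y‖ ≤ 1 := (Bidual.norm_lt_one hy).le
      have h2 := norm_coordCLM_le n
      calc ‖y (coordCLM n)‖ ≤ ‖y‖ * ‖coordCLM n‖ := y.le_opNorm _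
        _ ≤ 1 * 1 := by gcongr
        _ = 1 := one_mul 1
  refine tendsto_nhds_unique ((tendsto_canonicalExtension (diskInclusion n s) hz).congr' ?_)
    (((hGc (w n) (w n).2).tendsto.comp hlim).trans_eq (by rw [hGs]))
  filter_upwards [self_mem_nhdsWithin] with y hy
  exact aronBernerSeries_diskInclusion n s (Bidual.norm_lt_one hy)

theorem pointEval_coordA (w : ℕ → closedBall (0 : ℂ) 1) (n : ℕ) :
    pointEval w (coordA n) = w n := by
  rw [← diskInclusion_diskId, pointEval_diskInclusion, diskId_apply]

theorem tendstoUniformly_pointEval {X : Type*} (w : X → ℕ → closedBall (0 : ℂ) 1)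
    {f : ℕ → AUnif C0} {g : AUnif C0} (h : Tendsto f atTop (𝓝 g)) :
    TendstoUniformly (fun k x => pointEval (w x) (f k)) (fun x => pointEval (w x) g) atTop := by
  rw [Metric.tendstoUniformly_iff]
  intro ε hε
  filter_upwards [(tendsto_iff_norm_sub_tendsto_zero.1 h).eventually_lt_const hε] with k hk x
  rw [dist_comm, dist_eq_norm, ← map_sub]
  exact (norm_pointEval_le _ _).trans_lt hk

theorem continuous_pointEval {X : Type*} [TopologicalSpace X] (w : X → ℕ → closedBall (0 : ℂ) 1)
    (hw : ∀ n, Continuous fun x => w x n) (f : AUnif C0) :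
    Continuous fun x => pointEval (w x) f := by
  let S : Subalgebra ℂ (AUnif C0) :=
    { carrier := {f | Continuous fun x => pointEval (w x) f}
      add_mem' := fun {f g} hf hg => by
        simp only [Set.mem_ofPred_eq, map_add]; exact hf.add hg
      mul_mem' := fun {f g} hf hg => by
        simp only [Set.mem_ofPred_eq, map_mul]; exact hf.mul hg
      algebraMap_mem' := fun c => by
        simp only [Set.mem_ofPred_eq, AlgHom.commutes]; exact continuous_const }
  refine mem_of_isClosed_of_coordA_mem S (IsSeqClosed.isClosed fun f g hf hfg => ?_)
    (fun n => ?_) f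
  · exact (tendstoUniformly_pointEval w hfg).continuous (.of_forall hf)
  · change Continuous fun x => pointEval (w x) (coordA n)
    simp only [pointEval_coordA]
    exact continuous_subtype_val.comp (hw n)

theorem isHolomorphic_pointEval {E : Type*} [NormedAddCommGroup E] [NormedSpace ℂ E]
    (w : ball (0 : E) 1 → ℕ → closedBall (0 : ℂ) 1)
    (hw : ∀ n, IsHolomorphic fun x => (w x n : ℂ)) (f : AUnif C0) :
    IsHolomorphic fun x => pointEval (w x) f := by
  let S : Subalgebra ℂ (AUnif C0) :=
    { carrier := {f | IsHolomorphic fun x => pointEval (w x) f}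
      add_mem' := fun {f g} hf hg => by
        obtain ⟨G, hG, h⟩ := (isHolomorphic_iff _).1 hf
        obtain ⟨G', hG', h'⟩ := (isHolomorphic_iff _).1 hg
        exact (isHolomorphic_iff _).2 ⟨_, hG.add hG', fun x => by simp [← h x, ← h' x]⟩
      mul_mem' := fun {f g} hf hg => by
        obtain ⟨G, hG, h⟩ := (isHolomorphic_iff _).1 hf
        obtain ⟨G', hG', h'⟩ := (isHolomorphic_iff _).1 hg
        exact (isHolomorphic_iff _).2 ⟨_, hG.mul hG', fun x => by simp [← h x, ← h' x]⟩
      algebraMap_mem' := fun c =>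
        (isHolomorphic_iff _).2 ⟨fun _ => c, differentiableOn_const _, fun _ => by simp⟩ }
  refine mem_of_isClosed_of_coordA_mem S (IsSeqClosed.isClosed fun f g hf hfg => ?_)
    (fun n => ?_) f
  · exact isHolomorphic_of_tendstoUniformly hf (tendstoUniformly_pointEval w hfg)
  · change IsHolomorphic fun x => pointEval (w x) (coordA n)
    simp only [pointEval_coordA]
    exact hw n

/-- The restriction of the canonical extension to the `n`-th coordinate disk through `w`. -/
def sliceHom (w : ℕ → closedBall (0 : ℂ) 1) (n : ℕ) : AUnif C0 →ₐ[ℂ] DiskAlgebra where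
  toFun f :=
    ⟨⟨fun t => pointEval (Function.update w n t) f, continuous_pointEval _ (fun m => by
        by_cases h : m = n
        · subst h; simpa using continuous_id'
        · simpa [h] using continuous_const) f⟩,
      isHolomorphic_pointEval (fun t : ball (0 : ℂ) 1 =>
        Function.update w n ⟨t, ball_subset_closedBall t.2⟩) (fun m => by
        by_cases h : m = n
        · subst h
          exact (isHolomorphic_iff _).2 ⟨id, differentiableOn_id, fun _ => by simp⟩
        · exact (isHolomorphic_iff _).2
            ⟨fun _ => w m, differentiableOn_const _, fun _ => by simp [h]⟩) f⟩
  map_one' := by ext; simp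
  map_mul' _ _ := by ext; simp
  map_zero' := by ext; simp
  map_add' _ _ := by ext; simp
  commutes' _ := by ext t; exact AlgHom.commutes (pointEval _) _

theorem sliceHom_apply (w : ℕ → closedBall (0 : ℂ) 1) (n : ℕ) (f : AUnif C0)
    (t : closedBall (0 : ℂ) 1) : (sliceHom w n f).1 t = pointEval (Function.update w n t) f := rfl

theorem norm_sliceHom_le (w : ℕ → closedBall (0 : ℂ) 1) (n : ℕ) (f : AUnif C0) :
    ‖sliceHom w n f‖ ≤ ‖f‖ :=
  (ContinuousMap.norm_le _ (norm_nonneg _)).2 fun _ => norm_pointEval_le _ _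

theorem sliceHom_diskInclusion (w : ℕ → closedBall (0 : ℂ) 1) (n : ℕ) (s : DiskAlgebra) :
    sliceHom w n (diskInclusion n s) = s := by
  ext t
  rw [sliceHom_apply, pointEval_diskInclusion, Function.update_self]

theorem continuous_of_norm_le {A B : Type*} [NormedCommRing A] [NormedAlgebra ℂ A]
    [NormedCommRing B] [NormedAlgebra ℂ B] (φ : A →ₐ[ℂ] B) (h : ∀ a, ‖φ a‖ ≤ ‖a‖) :
    Continuous φ :=
  AddMonoidHomClass.continuous_of_bound φ 1 fun a => by simpa using h a

/-- Density of polynomials in the disk algebra, read off from the density on `c₀`: slicing in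
coordinate `0` turns that coordinate into the identity and the others into constants. -/
theorem mem_of_isClosed_of_diskId_mem (S : Subalgebra ℂ DiskAlgebra)
    (hS : IsClosed (S : Set DiskAlgebra)) (h : diskId ∈ S) (s : DiskAlgebra) : s ∈ S := by
  set w : ℕ → closedBall (0 : ℂ) 1 := fun _ => ⟨0, by simp⟩
  have := mem_of_isClosed_of_coordA_mem (S.comap (sliceHom w 0))
    (hS.preimage (continuous_of_norm_le _ (norm_sliceHom_le w 0))) (fun n => ?_)
    (diskInclusion 0 s)
  · rwa [Subalgebra.mem_comap, sliceHom_diskInclusion] at this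
  · rw [Subalgebra.mem_comap]
    by_cases hn : n = 0
    · subst hn
      rwa [← diskInclusion_diskId, sliceHom_diskInclusion]
    · have h0 : sliceHom w 0 (coordA n) = algebraMap ℂ DiskAlgebra (w n) := by
        ext t
        rw [sliceHom_apply, pointEval_coordA, Function.update_of_ne hn]
        rfl
      rw [h0]
      exact S.algebraMap_mem _

end PointEvaluation


/-! ### Homomorphisms into bounded holomorphic functions: unitality and contractivity. -/

section Spectra

theorem IsHolomorphic.continuous {E : Type*} [NormedAddCommGroup E] [NormedSpace ℂ E]
    {F : Type*} [NormedAddCommGroup F] [NormedSpace ℂ F] {f : ball (0 : E) 1 → F}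
    (hf : IsHolomorphic f) : Continuous f := by
  obtain ⟨G, hG, h⟩ := (isHolomorphic_iff _).1 hf
  exact (continuousOn_iff_continuous_domRestrict.1 hG.continuousOn).congr fun x => (h x).symm

/-- Evaluation at a point of the unit ball on `HInfty`. -/
def evalHInfty {E : Type*} [NormedAddCommGroup E] [NormedSpace ℂ E] (x : ball (0 : E) 1) :
    HInfty E →ₐ[ℂ] ℂ where
  toFun f := f.1 x
  map_one' := rfl
  map_mul' _ _ := rfl
  map_zero' := rfl
  map_add' _ _ := rfl
  commutes' _ := rfl

theorem evalHInfty_apply {E : Type*} [NormedAddCommGroup E] [NormedSpace ℂ E] (x : ball (0 : E) 1)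
    (f : HInfty E) : evalHInfty x f = f.1 x := rfl

/-- An idempotent takes only the values `0` and `1`, and the ball is connected. Applied to the image
of `1`, this makes every nonzero homomorphism unital. -/
theorem HInfty_eq_zero_or_one_of_idempotent {E : Type*} [NormedAddCommGroup E] [NormedSpace ℂ E]
    {e : HInfty E} (he : e * e = e) : e = 0 ∨ e = 1 := by
  have hval : ∀ x, e.1 x = 0 ∨ e.1 x = 1 := by
    intro x
    have := congrArg (evalHInfty x) he
    rw [map_mul, evalHInfty_apply] at this
    have h0 : e.1 x * (e.1 x - 1) = 0 := by rw [mul_sub, this, mul_one, sub_self]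
    exact (mul_eq_zero.1 h0).imp_right sub_eq_zero.1
  have hconn : PreconnectedSpace (ball (0 : E) 1) :=
    Subtype.preconnectedSpace (convex_ball (0 : E) 1).isPreconnected
  set x₀ : ball (0 : E) 1 := ⟨0, mem_ball_self one_pos⟩
  have hconst : ∀ x, e.1 x = e.1 x₀ := fun x =>
    isPreconnected_univ.constant_of_mapsTo (Set.toFinite ({0, 1} : Set ℂ)).isDiscrete e.1.continuous.continuousOn
      (fun y _ => hval y) (Set.mem_univ x) (Set.mem_univ x₀)
  rcases hval x₀ with h | h
  · left
    ext x
    exact (hconst x).trans h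
  · right
    ext x
    exact (hconst x).trans h

variable {A : Type*} [NormedCommRing A] [NormedAlgebra ℂ A]

theorem VectorSpectrum.map_one {E : Type*} [NormedAddCommGroup E] [NormedSpace ℂ E]
    (Φ : VectorSpectrum A (HInfty E)) : Φ 1 = 1 := by
  have h : Φ.1 1 * Φ.1 1 = Φ.1 1 := by rw [← map_mul, one_mul]
  refine (HInfty_eq_zero_or_one_of_idempotent h).resolve_left fun h0 => Φ.2 ?_
  ext1 a
  rw [← one_mul a, map_mul, h0, zero_mul]
  rfl

/-- Elements of the spectrum with values in `HInfty E` are unital. -/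
def VectorSpectrum.toAlgHom {E : Type*} [NormedAddCommGroup E] [NormedSpace ℂ E]
    (Φ : VectorSpectrum A (HInfty E)) : A →ₐ[ℂ] HInfty E where
  toFun a := Φ a
  map_one' := Φ.map_one
  map_mul' := map_mul Φ.1
  map_zero' := map_zero Φ.1
  map_add' := map_add Φ.1
  commutes' c := by
    rw [Algebra.algebraMap_eq_smul_one, Algebra.algebraMap_eq_smul_one, map_smul]
    exact congrArg (c • ·) Φ.map_one

theorem VectorSpectrum.ext {B : Type*} [NormedCommRing B] [NormedAlgebra ℂ B]
    {Φ Ψ : VectorSpectrum A B} (h : ∀ a, Φ a = Ψ a) : Φ = Ψ :=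
  Subtype.ext (NonUnitalAlgHom.ext h)

/-- A unital homomorphism as an element of the spectrum. -/
def VectorSpectrum.ofAlgHom {B : Type*} [NormedCommRing B] [NormedAlgebra ℂ B] [Nontrivial B]
    (φ : A →ₐ[ℂ] B) : VectorSpectrum A B :=
  ⟨(φ : A →ₙₐ[ℂ] B), fun h => one_ne_zero (α := B) (by
    rw [← _root_.map_one φ]
    exact DFunLike.congr_fun h 1)⟩

/-- Followed by evaluation at a point, `φ` is a character of a Banach algebra, hence automatically
contractive. -/
theorem norm_algHom_HInfty_le [CompleteSpace A] [NormOneClass A] {E : Type*}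
    [NormedAddCommGroup E] [NormedSpace ℂ E] (φ : A →ₐ[ℂ] HInfty E) (a : A) : ‖φ a‖ ≤ ‖a‖ :=
  (BoundedContinuousFunction.norm_le (norm_nonneg _)).2 fun x =>
    AlgHom.norm_apply_le_self ((evalHInfty x).comp φ) a

instance {E : Type*} [NormedAddCommGroup E] [NormedSpace ℂ E] : Nontrivial (HInfty E) :=
  (evalHInfty (⟨0, mem_ball_self one_pos⟩ : ball (0 : E) 1)).toRingHom.domain_nontrivial

instance {E : Type*} [NormedAddCommGroup E] [NormedSpace ℂ E] : Nonempty (ball (0 : E) 1) :=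
  ⟨⟨0, mem_ball_self one_pos⟩⟩

instance {E : Type*} [NormedAddCommGroup E] [NormedSpace ℂ E] : NormOneClass (AUnif E) :=
  ⟨norm_one (α := ball (0 : E) 1 →ᵇ ℂ)⟩

instance : Nonempty (closedBall (0 : ℂ) 1) := ⟨⟨0, by simp⟩⟩

instance : NormOneClass DiskAlgebra :=
  ⟨norm_one (α := C(closedBall (0 : ℂ) 1, ℂ))⟩

theorem mem_gleasonPart_self {B : Type*} [NormedCommRing B] [NormedAlgebra ℂ B]
    (Φ : VectorSpectrum A B) : Φ ∈ gleasonPart Φ := by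
  simp [gleasonPart, gleasonDist]

theorem isIsolated_iff {B : Type*} [NormedCommRing B] [NormedAlgebra ℂ B]
    {Φ : VectorSpectrum A B} : IsIsolated Φ ↔ ∀ Ψ, gleasonDist Φ Ψ < 2 → Ψ = Φ :=
  ⟨fun h Ψ hΨ => by
    have : Ψ ∈ gleasonPart Φ := hΨ
    rwa [h] at this,
  fun h => Set.Subset.antisymm (fun Ψ hΨ => h Ψ hΨ) (by
    rintro _ rfl
    exact mem_gleasonPart_self _)⟩

theorem enorm_sub_le_gleasonDist {B : Type*} [NormedCommRing B] [NormedAlgebra ℂ B]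
    (Φ Ψ : VectorSpectrum A B) {a : A} (ha : ‖a‖ ≤ 1) : ‖Φ a - Ψ a‖ₑ ≤ gleasonDist Φ Ψ :=
  le_iSup₂_of_le a ha le_rfl

end Spectra

/-! ### Composition homomorphisms and their Gleason parts. -/

section Composition

/-- The composition homomorphism on `AUnif C0` induced by a sequence of holomorphic functions into
the closed unit disk. -/
def compHom {E : Type*} [NormedAddCommGroup E] [NormedSpace ℂ E]
    (w : ball (0 : E) 1 → ℕ → closedBall (0 : ℂ) 1)
    (hw : ∀ n, IsHolomorphic fun x => (w x n : ℂ)) : AUnif C0 →ₐ[ℂ] HInfty E where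
  toFun f := ⟨BoundedContinuousFunction.ofNormedAddCommGroup (fun x => pointEval (w x) f)
    (isHolomorphic_pointEval w hw f).continuous ‖f‖ fun x => norm_pointEval_le (w x) f,
    isHolomorphic_pointEval w hw f⟩
  map_one' := by ext x; exact map_one (pointEval (w x))
  map_mul' f g := by ext x; exact map_mul (pointEval (w x)) f g
  map_zero' := by ext x; exact map_zero (pointEval (w x))
  map_add' f g := by ext x; exact map_add (pointEval (w x)) f g
  commutes' c := by ext x; exact AlgHom.commutes (pointEval (w x)) c

variable {E : Type*} [NormedAddCommGroup E] [NormedSpace ℂ E]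
  (w : ball (0 : E) 1 → ℕ → closedBall (0 : ℂ) 1)
  (hw : ∀ n, IsHolomorphic fun x => (w x n : ℂ))

theorem compHom_apply (f : AUnif C0) (x : ball (0 : E) 1) :
    (compHom w hw f).1 x = pointEval (w x) f := rfl

theorem compHom_diskInclusion_apply (n : ℕ) (s : DiskAlgebra) (x : ball (0 : E) 1) :
    (compHom w hw (diskInclusion n s)).1 x = s.1 (w x n) :=
  pointEval_diskInclusion (w x) n s

theorem algHom_AUnif_ext {φ ψ : AUnif C0 →ₐ[ℂ] HInfty E} (h : ∀ n, φ (coordA n) = ψ (coordA n)) :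
    φ = ψ := by
  ext1 f
  exact mem_of_isClosed_of_coordA_mem (AlgHom.equalizer φ ψ)
    (isClosed_eq (continuous_of_norm_le φ (norm_algHom_HInfty_le φ))
      (continuous_of_norm_le ψ (norm_algHom_HInfty_le ψ))) h f

theorem apply_diskId_mem_closedBall (ψ : DiskAlgebra →ₐ[ℂ] HInfty E) (x : ball (0 : E) 1) :
    (ψ diskId).1 x ∈ closedBall (0 : ℂ) 1 := by
  rw [mem_closedBall_zero_iff]
  refine ((ψ diskId).1.norm_coe_le_norm x).trans ((norm_algHom_HInfty_le ψ diskId).trans ?_)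
  exact (ContinuousMap.norm_le _ zero_le_one).2 fun z => mem_closedBall_zero_iff.1 z.2

/-- Both sides are continuous characters in `s` agreeing at the identity function, which generates a
dense subalgebra. -/
theorem algHom_DiskAlgebra_apply (ψ : DiskAlgebra →ₐ[ℂ] HInfty E) (s : DiskAlgebra)
    (x : ball (0 : E) 1) : (ψ s).1 x = s.1 ⟨(ψ diskId).1 x, apply_diskId_mem_closedBall ψ x⟩ := by
  let ev : DiskAlgebra →ₐ[ℂ] ℂ :=
    { toFun := fun s => s.1 ⟨(ψ diskId).1 x, apply_diskId_mem_closedBall ψ x⟩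
      map_one' := rfl
      map_mul' := fun _ _ => rfl
      map_zero' := rfl
      map_add' := fun _ _ => rfl
      commutes' := fun _ => rfl }
  have hc : ∀ χ : DiskAlgebra →ₐ[ℂ] ℂ, Continuous χ := fun χ =>
    continuous_of_norm_le χ (AlgHom.norm_apply_le_self χ)
  exact mem_of_isClosed_of_diskId_mem (AlgHom.equalizer ((evalHInfty x).comp ψ) ev)
    (isClosed_eq (hc _) (hc ev)) rfl s

theorem isIsolated_compHom_of_forall (h : ∀ n, IsIsolated
    (VectorSpectrum.ofAlgHom ((compHom w hw).comp (diskInclusion n)))) :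
    IsIsolated (VectorSpectrum.ofAlgHom (compHom w hw)) := by
  refine isIsolated_iff.2 fun Ψ hΨ => ?_
  have hcomp : ∀ n, Ψ.toAlgHom.comp (diskInclusion n) =
      (compHom w hw).comp (diskInclusion n) := by
    intro n
    have h1 := isIsolated_iff.1 (h n)
      (VectorSpectrum.ofAlgHom (Ψ.toAlgHom.comp (diskInclusion n))) (lt_of_le_of_lt ?_ hΨ)
    · ext1 s
      exact congrArg (fun Φ : VectorSpectrum DiskAlgebra (HInfty E) => Φ s) h1
    · exact iSup₂_le fun s hs => enorm_sub_le_gleasonDist (VectorSpectrum.ofAlgHom (compHom w hw)) Ψ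
        ((norm_diskInclusion_le n s).trans hs)
  have heq : Ψ.toAlgHom = compHom w hw := algHom_AUnif_ext fun n => by
    rw [← diskInclusion_diskId]
    exact DFunLike.congr_fun (hcomp n) diskId
  exact VectorSpectrum.ext fun f => DFunLike.congr_fun heq f

/-- A competitor `Ψ` of the `n`-th component is lifted to a competitor of the whole by replacing the
`n`-th coordinate of `w` with `u = Ψ(id)`. -/
theorem isIsolated_of_isIsolated_compHom
    (h : IsIsolated (VectorSpectrum.ofAlgHom (compHom w hw))) (n : ℕ) :
    IsIsolated (VectorSpectrum.ofAlgHom ((compHom w hw).comp (diskInclusion n))) := by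
  refine isIsolated_iff.2 fun Ψ hΨ => ?_
  set ψ := Ψ.toAlgHom with hψ
  set u : ball (0 : E) 1 → closedBall (0 : ℂ) 1 := fun x =>
    ⟨(ψ diskId).1 x, apply_diskId_mem_closedBall ψ x⟩ with hu
  set w' : ball (0 : E) 1 → ℕ → closedBall (0 : ℂ) 1 := fun x => Function.update (w x) n (u x)
    with hw'def
  have hw' : ∀ m, IsHolomorphic fun x => (w' x m : ℂ) := by
    intro m
    by_cases hm : m = n
    · subst hm
      simp only [hw'def, hu, Function.update_self]
      exact (ψ diskId).2
    · simpa [hw'def, hm] using hw m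
  -- At a fixed `x`, the points `w x` and `w' x` differ only in coordinate `n`, so `f` may be
  -- replaced by its slice through `w x`. The slice varies with `x`, but its norm never exceeds
  -- `‖f‖`.
  have hpt : ∀ (f : AUnif C0) (x : ball (0 : E) 1),
      (compHom w hw f).1 x - (compHom w' hw' f).1 x =
        (VectorSpectrum.ofAlgHom ((compHom w hw).comp (diskInclusion n)) (sliceHom (w x) n f) -
          Ψ (sliceHom (w x) n f)).1 x := by
    intro f x
    have h1 : (Ψ (sliceHom (w x) n f)).1 x = (compHom w' hw' f).1 x :=
      algHom_DiskAlgebra_apply ψ (sliceHom (w x) n f) x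
    have h2 : (VectorSpectrum.ofAlgHom ((compHom w hw).comp (diskInclusion n))
        (sliceHom (w x) n f)).1 x = (compHom w hw f).1 x := by
      refine (compHom_diskInclusion_apply w hw n _ x).trans ?_
      rw [sliceHom_apply, Function.update_eq_self, compHom_apply]
    rw [← h1, ← h2]
    rfl
  have hdist : gleasonDist (VectorSpectrum.ofAlgHom (compHom w hw))
      (VectorSpectrum.ofAlgHom (compHom w' hw')) < 2 := by
    refine lt_of_le_of_lt (iSup₂_le fun f hf => ?_) hΨ
    -- The pointwise estimate is against the single number `D < 2`: a bound `< 2` for each `f` and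
    -- `x` separately could still have supremum `2`.
    set D := gleasonDist (VectorSpectrum.ofAlgHom ((compHom w hw).comp (diskInclusion n))) Ψ
    have hD : D ≠ ⊤ := (hΨ.trans ENNReal.ofNat_lt_top).ne
    rw [← ofReal_norm, ENNReal.ofReal_le_iff_le_toReal hD]
    refine (BoundedContinuousFunction.norm_le ENNReal.toReal_nonneg).2 fun x => ?_
    have h1 := enorm_sub_le_gleasonDist
      (VectorSpectrum.ofAlgHom ((compHom w hw).comp (diskInclusion n))) Ψ
      ((norm_sliceHom_le (w x) n f).trans hf)
    rw [← ofReal_norm, ENNReal.ofReal_le_iff_le_toReal hD] at h1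
    refine le_trans (le_of_eq ?_) ((BoundedContinuousFunction.norm_coe_le_norm _ x).trans h1)
    exact congrArg norm (hpt f x)
  have heq := isIsolated_iff.1 h _ hdist
  have hu' : ∀ x, u x = w x n := by
    intro x
    have h1 : (compHom w' hw' (coordA n)).1 x = (compHom w hw (coordA n)).1 x :=
      congrArg (fun Φ : VectorSpectrum (AUnif C0) (HInfty E) => (Φ (coordA n)).1 x) heq
    rw [compHom_apply, compHom_apply, pointEval_coordA, pointEval_coordA] at h1
    refine Subtype.ext (Eq.trans ?_ h1)
    simp [hw'def]
  refine VectorSpectrum.ext fun s => ?_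
  ext x
  refine (algHom_DiskAlgebra_apply ψ s x).trans ?_
  refine Eq.trans ?_ (compHom_diskInclusion_apply w hw n s x).symm
  exact congrArg s.1 (hu' x)

theorem isHolomorphic_coord (g : closedUnitBallHInfty) (n : ℕ) :
    IsHolomorphic fun x => (coord g n x : ℂ) := by
  obtain ⟨G, hG, h⟩ := (isHolomorphic_iff _).1 g.2.1
  let L : LInfty →L[ℂ] ℂ := LinearMap.mkContinuous
    { toFun := fun z => z n
      map_add' := fun _ _ => rfl
      map_smul' := fun _ _ => rfl } 1 fun z => by
        rw [one_mul]
        exact lp.norm_apply_le_norm ENNReal.top_ne_zero z n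
  refine (isHolomorphic_iff _).2 ⟨fun x => L (G x),
    L.differentiable.comp_differentiableOn hG, fun x => ?_⟩
  exact congrArg L (h x)

end Composition

end PolydiskHom

end

theorem mainTheorem6 (g : PolydiskHom.closedUnitBallHInfty) :
    ∃ (Cg : PolydiskHom.VectorSpectrum (PolydiskHom.AUnif PolydiskHom.C0)
          (PolydiskHom.HInfty PolydiskHom.C0))
      (Cgn : ℕ → PolydiskHom.VectorSpectrum PolydiskHom.DiskAlgebra
          (PolydiskHom.HInfty PolydiskHom.C0)),
      PolydiskHom.IsComposition (fun x => g.1 x) Cg ∧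
      (∀ n : ℕ, PolydiskHom.IsDiskComposition (PolydiskHom.coord g n) (Cgn n)) ∧
      (PolydiskHom.IsIsolated Cg ↔ ∀ n : ℕ, PolydiskHom.IsIsolated (Cgn n)) := by
  have hw := PolydiskHom.isHolomorphic_coord g
  exact ⟨PolydiskHom.VectorSpectrum.ofAlgHom (PolydiskHom.compHom
      (fun x n => PolydiskHom.coord g n x) hw),
    fun n => PolydiskHom.VectorSpectrum.ofAlgHom ((PolydiskHom.compHom
      (fun x n => PolydiskHom.coord g n x) hw).comp (PolydiskHom.diskInclusion n)),
    -- The sequence of coordinates of `g x`, repackaged by `toLInfty`, is definitionally `g x`, and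
    -- `pointEval` unfolds to the canonical extension there.
    fun _ _ => rfl,
    fun n s x => PolydiskHom.compHom_diskInclusion_apply _ hw n s x,
    fun h n => PolydiskHom.isIsolated_of_isIsolated_compHom _ hw h n,
    fun h => PolydiskHom.isIsolated_compHom_of_forall _ hw h⟩
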